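/- Let $k\ge 1$ and $1\ge\lambda_1\ge\dots\ge\lambda_k>0$ be fixed. For $d>k$ let $\mathcal G_{\lambda,d}=\{OD_\lambda O^{T}: O\in\mathcal O(d)\}$ with $D_\lambda=\operatorname{diag}(\lambda_1,\dots,\lambda_k,0,\dots,0)\in\mathbb R^{d\times d}$, and let $\sigma_{\lambda,d}$ be the probability measure on $\mathcal G_{\lambda,d}$ that is the image of the normalized Haar measure on the orthogonal group $\mathcal O(d)$ under $O\mapsto OD_\lambda O^{T}$. Put $\langle X,Y\rangle=\operatorname{trace}(XY^{T})$ and $\|X\|_F^2=\langle X,X\rangle$. A random matrix $\mathcal P$ with values in $\mathcal G_{\lambda,d}$ is called a random cubature of strength $3$ if $$\mathbb E\,\langle\mathcal P,X\rangle^3=\int_{\mathcal G_{\lambda,d}}\langle P,X\rangle^3\,d\sigma_{\lambda,d}(P)\qquad\text{for all symmetric } X\in\mathbb R^{d\times d}.$$ For $x\in\mathbb R^d$ let $T_x=\{xz^{T}+zx^{T}: z\in\mathbb R^d\}$. Then there is a constant $K>0$, depending only on $k$ and $\lambda_1,\dots,\lambda_k$, such that for every $C_0\ge K$ there is a constant $c>0$,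 depending only on $C_0$, $k$ and $\lambda_1,\dots,\lambda_k$, with the following property. For all $d>k$, $n\ge 1$ and $x\in\mathbb R^d$, and for all independent random matrices $P_1,\dots,P_n$ that are identically distributed copies of a random cubature of strength $3$ in $\mathcal G_{\lambda,d}$, the map $\mathcal A_n(X)=(\langle X,P_j\rangle)_{j=1}^n\in\mathbb R^n$ (with the Euclidean norm on $\mathbb R^n$) satisfies $$\frac{1}{C_0d^2}\,\|X\|_F^2\;\le\;\frac1n\,\|\mathcal A_n(X)\|^2\qquad\text{for all }X\in T_x\text{ simultaneously},$$ with probability of failure at most $d^2e^{-cn/d}$. -/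

import Mathlib

open MeasureTheory ProbabilityTheory Matrix

namespace PhaseRetrieval

/-- The Borel (equivalently, entrywise product) sigma-algebra on real matrices. -/
instance instMeasurableSpaceMatrix (d : ℕ) : MeasurableSpace (Matrix (Fin d) (Fin d) ℝ) :=
  inferInstanceAs (MeasurableSpace (Fin d → Fin d → ℝ))

instance instBorelSpaceMatrix (d : ℕ) : BorelSpace (Matrix (Fin d) (Fin d) ℝ) :=
  inferInstanceAs (BorelSpace (Fin d → Fin d → ℝ))

instance instCompactSpaceOrthogonal (d : ℕ) :
    CompactSpace (Matrix.orthogonalGroup (Fin d) ℝ) := by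
  have hK : IsCompact (Set.matrix (Set.Icc (-1 : ℝ) 1) : Set (Matrix (Fin d) (Fin d) ℝ)) :=
    IsCompact.matrix isCompact_Icc
  have hcl : IsClosed ((Matrix.orthogonalGroup (Fin d) ℝ : Set (Matrix (Fin d) (Fin d) ℝ))) := by
    have h : ((Matrix.orthogonalGroup (Fin d) ℝ : Set (Matrix (Fin d) (Fin d) ℝ)))
        = {A | A * star A = 1} := by
      ext A
      exact Matrix.mem_orthogonalGroup_iff (Fin d) ℝ
    rw [h]
    exact isClosed_eq (continuous_id.mul continuous_star) continuous_const
  refine isCompact_iff_compactSpace.mp (hK.of_isClosed_subset hcl ?_)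
  intro A hA i j
  have h := entry_norm_bound_of_unitary (𝕜 := ℝ) hA i j
  rw [Real.norm_eq_abs] at h
  exact abs_le.mp h

/-- The Hilbert--Schmidt inner product `⟨X, Y⟩ = trace (X Yᵀ)`. -/
def hsInner {d : ℕ} (X Y : Matrix (Fin d) (Fin d) ℝ) : ℝ := (X * Yᵀ).trace

/-- The Frobenius norm, i.e. the norm induced by the Hilbert--Schmidt inner product. -/
noncomputable def frobNorm {d : ℕ} (X : Matrix (Fin d) (Fin d) ℝ) : ℝ :=
  Real.sqrt (hsInner X X)

/-- The diagonal matrix `diag (lam 0, …, lam (k - 1), 0, …, 0)` of size `d` (for `k ≤ d`). -/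
def diagMatrix {k : ℕ} (lam : Fin k → ℝ) (d : ℕ) : Matrix (Fin d) (Fin d) ℝ :=
  Matrix.diagonal fun i => if h : (i : ℕ) < k then lam ⟨i, h⟩ else 0

/-- `O D Oᵀ` for the fixed diagonal matrix `D`. -/
def conjDiag {k : ℕ} (lam : Fin k → ℝ) (d : ℕ) (O : Matrix.orthogonalGroup (Fin d) ℝ) :
    Matrix (Fin d) (Fin d) ℝ :=
  (O : Matrix (Fin d) (Fin d) ℝ) * diagMatrix lam d * (O : Matrix (Fin d) (Fin d) ℝ)ᵀ

/-- The set of measurement matrices: all `O D Oᵀ` with `O` orthogonal. -/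
def orbitSet {k : ℕ} (lam : Fin k → ℝ) (d : ℕ) : Set (Matrix (Fin d) (Fin d) ℝ) :=
  Set.range (conjDiag lam d)

/-- The Haar measure on the compact orthogonal group, normalized to total mass one. -/
noncomputable def haarOrthogonal (d : ℕ) : Measure (Matrix.orthogonalGroup (Fin d) ℝ) :=
  Measure.haarMeasure ⊤

/-- The orthogonally invariant probability measure on `orbitSet lam d`, as a measure on the
ambient matrix space: the image of the normalized Haar measure under `O ↦ O D Oᵀ`. -/
noncomputable def orbitMeasure {k : ℕ} (lam : Fin k → ℝ) (d : ℕ) :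
    Measure (Matrix (Fin d) (Fin d) ℝ) :=
  (haarOrthogonal d).map (conjDiag lam d)

/-- The `t`-th trace moment `E ⟨P, X⟩ ^ t` of a random matrix `P`. -/
noncomputable def traceMoment {Ω : Type*} [MeasurableSpace Ω] {d : ℕ} (t : ℕ)
    (P : Ω → Matrix (Fin d) (Fin d) ℝ) (μ : Measure Ω) (X : Matrix (Fin d) (Fin d) ℝ) : ℝ :=
  ∫ ω, hsInner (P ω) X ^ t ∂μ

/-- The `t`-th trace moment of the invariant probability measure on `orbitSet lam d`. -/
noncomputable def orbitTraceMoment {k : ℕ} (lam : Fin k → ℝ) (d t : ℕ)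
    (X : Matrix (Fin d) (Fin d) ℝ) : ℝ :=
  ∫ Q, hsInner Q X ^ t ∂(orbitMeasure lam d)

/-- `P` is a random cubature of strength `t` in `orbitSet lam d`: a random matrix with values in
`orbitSet lam d` whose `t`-th trace moments agree, on all symmetric matrices, with those of the
invariant probability measure. -/
structure IsRandomCubature {Ω : Type*} [MeasurableSpace Ω] {k : ℕ} (lam : Fin k → ℝ) (d t : ℕ)
    (P : Ω → Matrix (Fin d) (Fin d) ℝ) (μ : Measure Ω) : Prop where
  aemeasurable : AEMeasurable P μ
  mem_orbitSet : ∀ᵐ ω ∂μ, P ω ∈ orbitSet lam d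
  moment_eq : ∀ X : Matrix (Fin d) (Fin d) ℝ, X.IsSymm →
    traceMoment t P μ X = orbitTraceMoment lam d t X

/-- The tangent space `T_x = {x zᵀ + z xᵀ : z ∈ ℝᵈ}`. -/
def tangentSpace {d : ℕ} (x : Fin d → ℝ) : Set (Matrix (Fin d) (Fin d) ℝ) :=
  {X | ∃ z : Fin d → ℝ, X = vecMulVec x z + vecMulVec z x}

/-- The measurement map `X ↦ (⟨X, P_j⟩)_j` with values in Euclidean space. -/
noncomputable def measurementMap {d n : ℕ} (P : Fin n → Matrix (Fin d) (Fin d) ℝ)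
    (X : Matrix (Fin d) (Fin d) ℝ) : EuclideanSpace ℝ (Fin n) :=
  WithLp.toLp 2 fun j => hsInner X (P j)

end PhaseRetrieval

/-! After rescaling, `x` may be taken to be a unit vector. For `X = xzᵀ + zxᵀ` one has `⟨P, X⟩ = 2
(Px)·z` and `‖X‖_F² ≤ 4|z|²`, so the claim becomes a lower bound, of order `n/d²`, on the least
eigenvalue of the sum of the independent positive semidefinite rank-one matrices `(P_j x)(P_j x)ᵀ`.
This is a matrix Chernoff lower tail, and it needs only two moment bounds.

Mean: `E (x·Pz)² ≥ a|z|²` with `a` of order `d⁻²` (`le_integral_sq_dotProduct`). Invariance makes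
the second moment a combination of `‖X‖_F²` and `(tr X)²`, whose coefficients follow from the fixed
trace and Frobenius norm on the orbit.

Variance: squaring `(Px)(Px)ᵀ` multiplies it by `|Px|² ≤ x·Px`, because `0 ≤ P ≤ 1`. The second
moment of the summand is therefore bounded by `E (x·Px)(x·Pz)²`, a third moment of `P`, which is at
most `b|z|²` with `b` of order `d⁻³` (`integral_mul_sq_le`). This is why strength 3 suffices:
polarization gives mixed third moments, and second moments follow because `⟨P, 1⟩` is constant on
the orbit.

The tail bound is a Laplace transform argument: `exp_neg_le_quadratic` bounds each factor,
Golden-Thompson (`trace_exp_add_le`) decouples the sum (`integral_trace_exp_neg_sum_le`), and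
Markov's inequality at parameter `θ = a/b` gives failure probability at most `d · exp(-n a²/(4b))`,
where `a²/b` is of order `1/d`. -/

namespace PhaseRetrieval

/-! ### Trace inequalities for powers of products -/

section TraceInequalities

variable {ι : Type*} [Fintype ι]

theorem trace_transpose_mul_self_nonneg (A : Matrix ι ι ℝ) : 0 ≤ (Aᵀ * A).trace := by
  simp only [Matrix.trace, Matrix.diag, Matrix.mul_apply, Matrix.transpose_apply]
  exact Finset.sum_nonneg fun i _ => Finset.sum_nonneg fun j _ => mul_self_nonneg _

/-- The arithmetic-geometric form of the Cauchy-Schwarz inequality for the trace. -/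
theorem two_mul_trace_mul_le (A B : Matrix ι ι ℝ) :
    2 * (A * B).trace ≤ (Aᵀ * A).trace + (Bᵀ * B).trace := by
  have h := trace_transpose_mul_self_nonneg (Aᵀ - B)
  simp only [transpose_sub, transpose_transpose, sub_mul, mul_sub, trace_sub] at h
  have h1 : (Bᵀ * Aᵀ).trace = (A * B).trace := by
    rw [← transpose_mul, trace_transpose]
  rw [h1, trace_mul_comm A Aᵀ] at h
  linarith

theorem abs_trace_mul_self_le (A : Matrix ι ι ℝ) : |(A * A).trace| ≤ (Aᵀ * A).trace := by
  rw [abs_le]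
  have h1 := two_mul_trace_mul_le A A
  have h2 := two_mul_trace_mul_le (-A) A
  simp only [transpose_neg, neg_mul, mul_neg, neg_neg, trace_neg] at h2
  constructor <;> linarith

variable [DecidableEq ι]

theorem mul_pow_mul_eq (A B : Matrix ι ι ℝ) (n : ℕ) :
    (A * B) ^ n * A = A * (B * A) ^ n := by
  induction n with
  | zero => simp
  | succ n ih =>
    rw [pow_succ', mul_assoc, ih, pow_succ']
    simp only [mul_assoc]

theorem trace_mul_pow_comm (A B : Matrix ι ι ℝ) (n : ℕ) :
    ((A * B) ^ n).trace = ((B * A) ^ n).trace := by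
  cases n with
  | zero => simp
  | succ n =>
    rw [pow_succ, ← mul_assoc, mul_pow_mul_eq, mul_assoc, trace_mul_comm, mul_assoc, ← pow_succ]

/-- The two bounds feed each other in one induction. The first at level `m`, applied to `A * A`,
leaves a power of `(AᵀA)(AAᵀ)`, which the second splits, and Cauchy-Schwarz recombines since `AᵀA`
and `AAᵀ` have equal power traces. The first at level `m`, applied to `A * B`, leaves a power of
`A²B²`, to which the second applies again. -/
theorem abs_trace_pow_and_trace_mul_pow (m : ℕ) :
    (∀ A : Matrix ι ι ℝ, |(A ^ 2 ^ (m + 1)).trace| ≤ ((Aᵀ * A) ^ 2 ^ m).trace) ∧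
      ∀ A B : Matrix ι ι ℝ, A.IsSymm → B.IsSymm →
        ((A * B) ^ 2 ^ m).trace ≤ (A ^ 2 ^ m * B ^ 2 ^ m).trace := by
  induction m with
  | zero =>
    refine ⟨fun A => ?_, fun A B _ _ => by simp⟩
    simpa [pow_two] using abs_trace_mul_self_le A
  | succ m ih =>
    obtain ⟨ihC, ihG⟩ := ih
    have hC : ∀ A : Matrix ι ι ℝ,
        |(A ^ 2 ^ (m + 1 + 1)).trace| ≤ ((Aᵀ * A) ^ 2 ^ (m + 1)).trace := by
      intro A
      have e : A ^ 2 ^ (m + 1 + 1) = (A * A) ^ 2 ^ (m + 1) := by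
        rw [← pow_two, ← pow_mul, ← pow_succ']
      rw [e]
      refine (ihC (A * A)).trans ?_
      have hP : (A * Aᵀ).IsSymm := by simp [IsSymm, transpose_mul]
      have hQ : (Aᵀ * A).IsSymm := by simp [IsSymm, transpose_mul]
      have e2 : (((A * A)ᵀ * (A * A)) ^ 2 ^ m).trace = (((Aᵀ * A) * (A * Aᵀ)) ^ 2 ^ m).trace := by
        rw [transpose_mul, show Aᵀ * Aᵀ * (A * A) = Aᵀ * (Aᵀ * A * A) by simp only [mul_assoc],
          trace_mul_pow_comm]
        simp only [mul_assoc]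
      rw [e2]
      refine (ihG _ _ hQ hP).trans ?_
      have h := two_mul_trace_mul_le ((Aᵀ * A) ^ 2 ^ m) ((A * Aᵀ) ^ 2 ^ m)
      rw [transpose_pow, transpose_pow, hP, hQ, ← pow_add, ← pow_add,
        ← two_mul, ← pow_succ', trace_mul_pow_comm A Aᵀ] at h
      linarith
    refine ⟨hC, fun A B hA hB => ?_⟩
    refine (le_abs_self _).trans ((ihC (A * B)).trans ?_)
    have e2 : (((A * B)ᵀ * (A * B)) ^ 2 ^ m).trace = ((A ^ 2 * B ^ 2) ^ 2 ^ m).trace := by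
      rw [transpose_mul, hA, hB, show B * A * (A * B) = B * (A * A * B) by simp only [mul_assoc],
        trace_mul_pow_comm]
      simp only [mul_assoc, pow_two]
    rw [e2]
    refine (ihG _ _ (hA.pow 2) (hB.pow 2)).trans ?_
    rw [← pow_mul, ← pow_mul, ← pow_succ']

theorem trace_mul_pow_two_pow_le {A B : Matrix ι ι ℝ} (hA : A.IsSymm) (hB : B.IsSymm) (m : ℕ) :
    ((A * B) ^ 2 ^ m).trace ≤ (A ^ 2 ^ m * B ^ 2 ^ m).trace :=
  (abs_trace_pow_and_trace_mul_pow m).2 A B hA hB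

end TraceInequalities

/-! ### The Lie product formula -/

section LieProduct

variable {𝔸 : Type*} [NormedRing 𝔸] [NormOneClass 𝔸]

theorem norm_pow_sub_pow_le (x y : 𝔸) {r : ℝ} (hx : ‖x‖ ≤ r) (hy : ‖y‖ ≤ r) (n : ℕ) :
    ‖x ^ n - y ^ n‖ ≤ n * r ^ (n - 1) * ‖x - y‖ := by
  have hr : 0 ≤ r := (norm_nonneg x).trans hx
  induction n with
  | zero => simp
  | succ n ih =>
    have e : x ^ (n + 1) - y ^ (n + 1) = x ^ n * (x - y) + (x ^ n - y ^ n) * y := by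
      rw [pow_succ, pow_succ]; noncomm_ring
    have h1 : ‖x ^ n * (x - y)‖ ≤ r ^ n * ‖x - y‖ :=
      (norm_mul_le _ _).trans (mul_le_mul_of_nonneg_right
        ((norm_pow_le x n).trans (pow_le_pow_left₀ (norm_nonneg _) hx n)) (norm_nonneg _))
    have h2 : ‖(x ^ n - y ^ n) * y‖ ≤ (n * r ^ (n - 1) * ‖x - y‖) * r :=
      (norm_mul_le _ _).trans (mul_le_mul ih hy (norm_nonneg _) (by positivity))
    have h3 : (n : ℝ) * r ^ (n - 1) * ‖x - y‖ * r = n * r ^ n * ‖x - y‖ := by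
      cases n with
      | zero => simp
      | succ n => simp only [Nat.add_sub_cancel]; ring
    rw [e]
    refine (norm_add_le _ _).trans ?_
    simp only [Nat.add_sub_cancel]
    push_cast
    linarith

variable [NormedAlgebra ℝ 𝔸]

open NormedSpace in
theorem norm_exp_le_exp_norm (x : 𝔸) : ‖exp x‖ ≤ Real.exp ‖x‖ := by
  have h : ∀ n : ℕ, ‖((n.factorial : ℝ)⁻¹) • x ^ n‖ ≤ ‖x‖ ^ n / n.factorial := by
    intro n
    rw [norm_smul, norm_inv, Real.norm_natCast, div_eq_inv_mul]
    gcongr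
    exact norm_pow_le x n
  rw [exp_eq_tsum ℝ, Real.exp_eq_exp_ℝ, exp_eq_tsum_div]
  exact tsum_of_norm_bounded (Real.summable_pow_div_factorial ‖x‖).hasSum h

variable [CompleteSpace 𝔸]

open NormedSpace Filter Topology in
/-- The Lie product formula along a sequence of exponents tending to infinity. -/
theorem tendsto_exp_mul_exp_pow (A B : 𝔸) {u : ℕ → ℕ} (hu : Tendsto u atTop atTop) :
    Tendsto (fun m => (exp ((u m : ℝ)⁻¹ • A) * exp ((u m : ℝ)⁻¹ • B)) ^ u m) atTop
      (𝓝 (exp (A + B))) := by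
  set R : ℝ := ‖A‖ + ‖B‖ with hR
  -- The two curves agree to first order at `0`, so their difference at `1/N` is `o(1/N)`;
  -- telescoping the `N`-th powers costs only a factor `N · exp R`.
  have hd : HasDerivAt (fun t : ℝ => exp (t • A) * exp (t • B) - exp (t • (A + B))) 0 0 := by
    have hA := hasDerivAt_exp_smul_const (𝕂 := ℝ) A 0
    have hB := hasDerivAt_exp_smul_const (𝕂 := ℝ) B 0
    have hAB := hasDerivAt_exp_smul_const (𝕂 := ℝ) (A + B) 0
    have := (hA.mul hB).sub hAB
    exact this.congr_deriv (by simp)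
  have hlim : Tendsto (fun m => (u m : ℝ) * ‖exp ((u m : ℝ)⁻¹ • A) * exp ((u m : ℝ)⁻¹ • B)
      - exp ((u m : ℝ)⁻¹ • (A + B))‖) atTop (𝓝 0) := by
    have h1 := hd.tendsto_slope_zero
    simp only [zero_add, zero_smul, exp_zero, mul_one, sub_self, sub_zero] at h1
    have hinv : Tendsto (fun m => (u m : ℝ)⁻¹) atTop (𝓝[≠] 0) := by
      rw [tendsto_nhdsWithin_iff]
      refine ⟨tendsto_inv_atTop_zero.comp (tendsto_natCast_atTop_atTop.comp hu), ?_⟩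
      filter_upwards [hu.eventually_ge_atTop 1] with m hm
      simp only [Set.mem_compl_iff, Set.mem_singleton_iff, inv_eq_zero, Nat.cast_eq_zero]
      omega
    have h2 := (h1.comp hinv).norm
    simpa [Function.comp_def, norm_smul] using h2
  rw [tendsto_iff_norm_sub_tendsto_zero]
  have hlim2 : Tendsto (fun m => Real.exp R * ((u m : ℝ) *
      ‖exp ((u m : ℝ)⁻¹ • A) * exp ((u m : ℝ)⁻¹ • B) - exp ((u m : ℝ)⁻¹ • (A + B))‖))
      atTop (𝓝 0) := by simpa using hlim.const_mul (Real.exp R)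
  refine squeeze_zero' (Eventually.of_forall fun _ => norm_nonneg _) ?_ hlim2
  filter_upwards [hu.eventually_ge_atTop 1] with m hm
  have hm0 : (0 : ℝ) < u m := by exact_mod_cast hm
  set N := u m with hN
  have hy : exp (A + B) = exp ((N : ℝ)⁻¹ • (A + B)) ^ N := by
    let := NormedAlgebra.restrictScalars ℚ ℝ 𝔸
    rw [← NormedSpace.exp_nsmul, ← Nat.cast_smul_eq_nsmul ℝ, smul_smul, mul_inv_cancel₀ hm0.ne', one_smul]
  have bound : ∀ C : 𝔸, ‖exp ((N : ℝ)⁻¹ • C)‖ ≤ Real.exp ((N : ℝ)⁻¹ * ‖C‖) := fun C => by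
    refine (norm_exp_le_exp_norm _).trans (le_of_eq ?_)
    rw [norm_smul, norm_inv, Real.norm_natCast]
  have hx' : ‖exp ((N : ℝ)⁻¹ • A) * exp ((N : ℝ)⁻¹ • B)‖ ≤ Real.exp ((N : ℝ)⁻¹ * R) := by
    refine (norm_mul_le _ _).trans ?_
    rw [hR, mul_add, Real.exp_add]
    exact mul_le_mul (bound A) (bound B) (norm_nonneg _) (Real.exp_pos _).le
  have hy' : ‖exp ((N : ℝ)⁻¹ • (A + B))‖ ≤ Real.exp ((N : ℝ)⁻¹ * R) := by
    refine (bound _).trans (Real.exp_le_exp.mpr ?_)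
    gcongr
    exact norm_add_le A B
  rw [hy]
  refine (norm_pow_sub_pow_le _ _ hx' hy' N).trans ?_
  rw [← mul_assoc, mul_comm (N : ℝ)]
  refine mul_le_mul_of_nonneg_right (mul_le_mul_of_nonneg_right ?_ hm0.le) (norm_nonneg _)
  rw [← Real.exp_nat_mul]
  refine Real.exp_le_exp.mpr ?_
  have hR0 : 0 ≤ R := by positivity
  have : ((N - 1 : ℕ) : ℝ) ≤ N := by exact_mod_cast Nat.sub_le N 1
  calc ((N - 1 : ℕ) : ℝ) * ((N : ℝ)⁻¹ * R) ≤ N * ((N : ℝ)⁻¹ * R) := by gcongr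
    _ = R := by rw [← mul_assoc, mul_inv_cancel₀ hm0.ne', one_mul]

end LieProduct

/-! ### The Golden-Thompson inequality -/

section GoldenThompson

variable {ι : Type*} [Fintype ι] [DecidableEq ι]

attribute [local instance] Matrix.linftyOpNormedRing Matrix.linftyOpNormedAlgebra in
open NormedSpace Filter Topology in
/-- The Golden-Thompson inequality for real symmetric matrices. -/
theorem trace_exp_add_le {A B : Matrix ι ι ℝ} (hA : A.IsSymm) (hB : B.IsSymm) :
    (exp (A + B)).trace ≤ (exp A * exp B).trace := by
  rcases isEmpty_or_nonempty ι with hι | hι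
  · simp [Matrix.trace]
  have hlim := tendsto_exp_mul_exp_pow A B
    (tendsto_pow_atTop_atTop_of_one_lt (r := 2) (by norm_num))
  have htr : Continuous fun M : Matrix ι ι ℝ => M.trace := continuous_id.matrix_trace
  refine le_of_tendsto ((htr.tendsto _).comp hlim) (Eventually.of_forall fun m => ?_)
  have hpow : ∀ C : Matrix ι ι ℝ, exp (((2 ^ m : ℕ) : ℝ)⁻¹ • C) ^ 2 ^ m = exp C := by
    intro C
    rw [← Matrix.exp_nsmul, ← Nat.cast_smul_eq_nsmul ℝ, smul_smul, mul_inv_cancel₀ (by positivity),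
      one_smul]
  -- With the exponents `A/2^m` and `B/2^m`, the right side is independent of `m` while the left
  -- side converges by the Lie formula.
  have h := trace_mul_pow_two_pow_le (A := exp (((2 ^ m : ℕ) : ℝ)⁻¹ • A))
    (B := exp (((2 ^ m : ℕ) : ℝ)⁻¹ • B)) (hA.smul _).exp (hB.smul _).exp m
  rwa [hpow, hpow] at h

end GoldenThompson

/-! ### Exponentials of symmetric matrices -/

section SymmetricExponential

variable {ι : Type*} [Fintype ι] [DecidableEq ι]

theorem exists_orthogonal_diagonalization {A : Matrix ι ι ℝ} (hA : A.IsSymm) :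
    ∃ U ∈ Matrix.orthogonalGroup ι ℝ, ∃ v : ι → ℝ, A = U * diagonal v * Uᵀ := by
  have hH : A.IsHermitian := by
    rw [IsHermitian, conjTranspose_eq_transpose_of_trivial]; exact hA
  refine ⟨hH.eigenvectorUnitary, hH.eigenvectorUnitary.2, hH.eigenvalues, ?_⟩
  have h := hH.spectral_theorem
  rw [Unitary.conjStarAlgAut_apply] at h
  simpa [star_eq_conjTranspose] using h

theorem mul_transpose_of_mem_orthogonalGroup {U : Matrix ι ι ℝ}
    (hU : U ∈ Matrix.orthogonalGroup ι ℝ) : U * Uᵀ = 1 :=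
  (Matrix.mem_orthogonalGroup_iff ι ℝ).mp hU

theorem transpose_mul_of_mem_orthogonalGroup {U : Matrix ι ι ℝ}
    (hU : U ∈ Matrix.orthogonalGroup ι ℝ) : Uᵀ * U = 1 :=
  (Matrix.mem_orthogonalGroup_iff' ι ℝ).mp hU

theorem exp_orthogonal_conj_diagonal {U : Matrix ι ι ℝ} (hU : U ∈ Matrix.orthogonalGroup ι ℝ)
    (v : ι → ℝ) : NormedSpace.exp (U * diagonal v * Uᵀ) =
      U * diagonal (fun i => Real.exp (v i)) * Uᵀ := by
  have h1 := mul_transpose_of_mem_orthogonalGroup hU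
  have hinv : U⁻¹ = Uᵀ := Matrix.inv_eq_right_inv h1
  have hunit : IsUnit U :=
    IsUnit.of_mul_eq_one Uᵀ h1
  rw [← hinv, Matrix.exp_conj _ _ hunit, Matrix.exp_diagonal]
  congr 3
  funext i
  rw [Pi.coe_exp, Real.exp_eq_exp_ℝ]

theorem dotProduct_conj_diagonal (U : Matrix ι ι ℝ) (v z : ι → ℝ) :
    z ⬝ᵥ (U * diagonal v * Uᵀ) *ᵥ z = ∑ i, v i * (Uᵀ *ᵥ z) i ^ 2 := by
  rw [← mulVec_mulVec, ← mulVec_mulVec, dotProduct_mulVec, ← mulVec_transpose]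
  simp only [dotProduct, mulVec_diagonal]
  exact Finset.sum_congr rfl fun i _ => by ring

theorem dotProduct_self_eq_sum_sq {U : Matrix ι ι ℝ} (hU : U ∈ Matrix.orthogonalGroup ι ℝ)
    (z : ι → ℝ) : z ⬝ᵥ z = ∑ i, (Uᵀ *ᵥ z) i ^ 2 := by
  have h := dotProduct_conj_diagonal U (fun _ => 1) z
  rw [diagonal_one, mul_one, mul_transpose_of_mem_orthogonalGroup hU, one_mulVec] at h
  simpa using h

/-- Since `e^m ≥ 1 + m + m²/2` and `(1 - m + m²/2)(1 + m + m²/2) = 1 + m⁴/4 ≥ 1`. There is no upper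
restriction on `m`, so the tail bound never depends on the size of the summands. -/
theorem exp_neg_le_quadratic {m : ℝ} (hm : 0 ≤ m) : Real.exp (-m) ≤ 1 - m + 2⁻¹ * m ^ 2 := by
  have h := Real.quadratic_le_exp_of_nonneg hm
  have h2 : Real.exp (-m) * Real.exp m = 1 := by rw [← Real.exp_add]; simp
  have h3 := Real.exp_pos (-m)
  have h4 : Real.exp (-m) * (1 + m + m ^ 2 / 2) ≤ 1 := by
    exact (mul_le_mul_of_nonneg_left h h3.le).trans_eq h2
  have h5 : 0 < 1 - m + 2⁻¹ * m ^ 2 := by nlinarith [sq_nonneg (m - 1)]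
  nlinarith [mul_le_mul_of_nonneg_right h4 h5.le, sq_nonneg (m ^ 2), mul_nonneg h3.le (sq_nonneg (m ^ 2))]

theorem dotProduct_exp_neg_le {M : Matrix ι ι ℝ} (hM : M.IsSymm)
    (hpos : ∀ z, 0 ≤ z ⬝ᵥ M *ᵥ z) (z : ι → ℝ) :
    z ⬝ᵥ NormedSpace.exp (-M) *ᵥ z ≤ z ⬝ᵥ (1 - M + (2⁻¹ : ℝ) • M ^ 2) *ᵥ z := by
  obtain ⟨U, hU, v, rfl⟩ := exists_orthogonal_diagonalization hM
  have hUU := transpose_mul_of_mem_orthogonalGroup hU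
  have hv : ∀ i, 0 ≤ v i := fun i => by
    have h := hpos (U *ᵥ Pi.single i 1)
    rw [dotProduct_conj_diagonal, mulVec_mulVec, hUU, one_mulVec] at h
    simpa [Pi.single_apply] using h
  have h1 : -(U * diagonal v * Uᵀ) = U * diagonal (-v) * Uᵀ := by
    rw [show -v = fun i => -v i from rfl, ← diagonal_neg, mul_neg, neg_mul]
  have h2 : (1 : Matrix ι ι ℝ) - U * diagonal v * Uᵀ + (2⁻¹ : ℝ) • (U * diagonal v * Uᵀ) ^ 2 =
      U * diagonal (fun i => 1 - v i + 2⁻¹ * v i ^ 2) * Uᵀ := by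
    have e : (U * diagonal v * Uᵀ) ^ 2 = U * diagonal (fun i => v i ^ 2) * Uᵀ := by
      rw [pow_two, show U * diagonal v * Uᵀ * (U * diagonal v * Uᵀ) =
        U * diagonal v * (Uᵀ * U) * diagonal v * Uᵀ by simp only [mul_assoc], hUU, mul_one,
        mul_assoc U, diagonal_mul_diagonal]
      simp only [pow_two]
    have e2 : (diagonal fun i => 1 - v i + 2⁻¹ * v i ^ 2 : Matrix ι ι ℝ) =
        1 - diagonal v + (2⁻¹ : ℝ) • diagonal (fun i => v i ^ 2) := by
      rw [← diagonal_one, ← diagonal_smul, diagonal_sub, diagonal_add]; rfl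
    rw [e, e2, mul_add, add_mul, mul_sub, sub_mul, mul_one,
      mul_transpose_of_mem_orthogonalGroup hU, Matrix.mul_smul,
      Matrix.smul_mul]
  rw [h1, exp_orthogonal_conj_diagonal hU, h2, dotProduct_conj_diagonal, dotProduct_conj_diagonal]
  refine Finset.sum_le_sum fun i _ => mul_le_mul_of_nonneg_right ?_ (sq_nonneg _)
  exact exp_neg_le_quadratic (hv i)

/-- A Rayleigh quotient at most `t` forces an eigenvalue at most `t`, and its exponential is one of
the positive terms of the trace. -/
theorem exp_neg_le_trace_exp_neg {A : Matrix ι ι ℝ} (hA : A.IsSymm) {t : ℝ} {z : ι → ℝ}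
    (hz : z ≠ 0) (h : z ⬝ᵥ A *ᵥ z ≤ t * (z ⬝ᵥ z)) :
    Real.exp (-t) ≤ (NormedSpace.exp (-A)).trace := by
  obtain ⟨U, hU, v, rfl⟩ := exists_orthogonal_diagonalization hA
  have hUU := transpose_mul_of_mem_orthogonalGroup hU
  have h1 : -(U * diagonal v * Uᵀ) = U * diagonal (-v) * Uᵀ := by
    rw [show -v = fun i => -v i from rfl, ← diagonal_neg, mul_neg, neg_mul]
  rw [h1, exp_orthogonal_conj_diagonal hU, trace_mul_comm, ← mul_assoc, hUU, one_mul,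
    trace_diagonal]
  obtain ⟨i, hi⟩ : ∃ i, v i ≤ t := by
    by_contra! hlt
    rw [dotProduct_conj_diagonal, dotProduct_self_eq_sum_sq hU, Finset.mul_sum] at h
    have h0 : ∑ i, (v i - t) * (Uᵀ *ᵥ z) i ^ 2 ≤ 0 := by
      simp only [sub_mul, Finset.sum_sub_distrib]; linarith
    have h00 : ∀ i ∈ Finset.univ, 0 ≤ (v i - t) * (Uᵀ *ᵥ z) i ^ 2 := fun i _ =>
      mul_nonneg (sub_nonneg.mpr (hlt i).le) (sq_nonneg _)
    have h000 := (Finset.sum_eq_zero_iff_of_nonneg h00).mp (le_antisymm h0 (Finset.sum_nonneg h00))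
    have hw : Uᵀ *ᵥ z = 0 := by
      funext i
      rcases mul_eq_zero.mp (h000 i (Finset.mem_univ i)) with h4 | h4
      · linarith [hlt i]
      · simpa using h4
    apply hz
    rw [← one_mulVec z, ← mul_transpose_of_mem_orthogonalGroup hU, ← mulVec_mulVec, hw,
      mulVec_zero]
  refine le_trans (Real.exp_le_exp.mpr (neg_le_neg hi)) ?_
  exact Finset.single_le_sum (f := fun i => Real.exp ((-v) i)) (fun _ _ => (Real.exp_pos _).le)
    (Finset.mem_univ i)

/-- Writing `exp A = S²` with `S = exp (A/2)` symmetric turns the trace into the sum of the form of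
`B` over the columns of `S`. -/
theorem trace_exp_mul_nonneg {A B : Matrix ι ι ℝ} (hA : A.IsSymm)
    (hB : ∀ z, 0 ≤ z ⬝ᵥ B *ᵥ z) : 0 ≤ (NormedSpace.exp A * B).trace := by
  set S := NormedSpace.exp ((2⁻¹ : ℝ) • A) with hS
  have hSs : Sᵀ = S := (hA.smul _).exp
  have h1 : NormedSpace.exp A = S * S := by
    rw [← pow_two, hS, ← Matrix.exp_nsmul, ← Nat.cast_smul_eq_nsmul ℝ, smul_smul]
    norm_num
  have h2 : (NormedSpace.exp A * B).trace = (Sᵀ * (B * S)).trace := by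
    rw [h1, hSs, mul_assoc, trace_mul_comm, mul_assoc]
  rw [h2]
  exact Finset.sum_nonneg fun i _ => hB (S.col i)

end SymmetricExponential

/-! ### The matrix Laplace transform of an independent sum -/

section LaplaceTransform

instance instSecondCountableTopologyMatrix (d : ℕ) :
    SecondCountableTopology (Matrix (Fin d) (Fin d) ℝ) :=
  inferInstanceAs (SecondCountableTopology (Fin d → Fin d → ℝ))

variable {Ω : Type*} [MeasurableSpace Ω] {μ : Measure Ω} {d : ℕ}

theorem isCompact_entrywise_bounded (C : ℝ) :
    IsCompact {A : Matrix (Fin d) (Fin d) ℝ | ∀ a b, |A a b| ≤ C} := by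
  have h : IsCompact (Set.matrix (Set.Icc (-C) C) : Set (Matrix (Fin d) (Fin d) ℝ)) :=
    IsCompact.matrix isCompact_Icc
  convert h using 1
  ext A
  simp only [Set.mem_ofPred_eq, abs_le]
  rfl

theorem integrable_continuous_comp [IsFiniteMeasure μ] {A : Ω → Matrix (Fin d) (Fin d) ℝ}
    (hA : AEMeasurable A μ) {C : ℝ} (hC : ∀ᵐ ω ∂μ, ∀ a b, |A ω a b| ≤ C)
    {f : Matrix (Fin d) (Fin d) ℝ → ℝ} (hf : Continuous f) :
    Integrable (fun ω => f (A ω)) μ := by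
  obtain ⟨B, hB⟩ := (isCompact_entrywise_bounded (d := d) C).exists_bound_of_continuousOn
    hf.continuousOn
  refine Integrable.of_bound (hf.measurable.comp_aemeasurable hA).aestronglyMeasurable B ?_
  filter_upwards [hC] with ω hω using hB _ hω

attribute [local instance] Matrix.linftyOpNormedRing Matrix.linftyOpNormedAlgebra in
theorem continuous_matrix_exp :
    Continuous (NormedSpace.exp : Matrix (Fin d) (Fin d) ℝ → Matrix (Fin d) (Fin d) ℝ) := by
  let : NormedAlgebra ℚ (Matrix (Fin d) (Fin d) ℝ) := NormedAlgebra.restrictScalars ℚ ℝ _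
  exact NormedSpace.exp_continuous

theorem continuous_exp_neg :
    Continuous fun A : Matrix (Fin d) (Fin d) ℝ => NormedSpace.exp (-A) :=
  continuous_matrix_exp.comp continuous_neg

theorem dotProduct_mulVec_eq_sum (A : Matrix (Fin d) (Fin d) ℝ) (z : Fin d → ℝ) :
    z ⬝ᵥ A *ᵥ z = ∑ a, ∑ b, A a b * (z a * z b) := by
  simp only [dotProduct, mulVec, Finset.mul_sum]
  exact Finset.sum_congr rfl fun a _ => Finset.sum_congr rfl fun b _ => by ring

/-- Iterating the Golden-Thompson inequality over independent summands bounds the matrix Laplace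
transform of a sum of positive semidefinite random matrices. -/
theorem integral_trace_exp_neg_sum_le [IsProbabilityMeasure μ] {ι : Type*}
    {M : ι → Ω → Matrix (Fin d) (Fin d) ℝ} (hindep : iIndepFun M μ)
    (hmeas : ∀ j, AEMeasurable (M j) μ) (hsymm : ∀ j, ∀ᵐ ω ∂μ, (M j ω).IsSymm)
    (hpos : ∀ j, ∀ᵐ ω ∂μ, ∀ z, 0 ≤ z ⬝ᵥ M j ω *ᵥ z) {C : ℝ}
    (hC : ∀ j, ∀ᵐ ω ∂μ, ∀ a b, |M j ω a b| ≤ C) {ρ : ℝ} (hρ : 0 ≤ ρ)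
    (hmean : ∀ j z, ∫ ω, z ⬝ᵥ (1 - M j ω + (2⁻¹ : ℝ) • M j ω ^ 2) *ᵥ z ∂μ ≤ ρ * (z ⬝ᵥ z))
    (s : Finset ι) :
    ∫ ω, (NormedSpace.exp (-∑ j ∈ s, M j ω)).trace ∂μ ≤ ρ ^ s.card * d := by
  classical
  induction s using Finset.induction_on with
  | empty => simp
  | insert i s hi ih =>
    set S : Ω → Matrix (Fin d) (Fin d) ℝ := fun ω => ∑ j ∈ s, M j ω with hS
    have hSsum : S = ∑ j ∈ s, M j := by ext1 ω; simp [hS]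
    have hSmeas : AEMeasurable S μ := by
      rw [hSsum]; exact Finset.aemeasurable_sum s fun j _ => hmeas j
    have hSsymm : ∀ᵐ ω ∂μ, (S ω).IsSymm := by
      filter_upwards [(Finset.eventually_all s).mpr fun j _ => hsymm j] with ω hω
      rw [IsSymm, hS, transpose_sum]
      exact Finset.sum_congr rfl hω
    have hSC : ∀ᵐ ω ∂μ, ∀ a b, |S ω a b| ≤ s.card * C := by
      filter_upwards [(Finset.eventually_all s).mpr fun j _ => hC j] with ω hω a b
      simp only [hS, Matrix.sum_apply]
      refine (Finset.abs_sum_le_sum_abs _ _).trans ?_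
      refine (Finset.sum_le_sum fun j hj => hω j hj a b).trans ?_
      simp
    have hind : IndepFun S (M i) μ := by
      rw [hSsum]
      exact hindep.indepFun_finsetSum_of_notMem₀ hmeas hi
    let H : Ω → Matrix (Fin d) (Fin d) ℝ := fun ω => NormedSpace.exp (-S ω)
    let q : Matrix (Fin d) (Fin d) ℝ → Matrix (Fin d) (Fin d) ℝ :=
      fun A => 1 - A + (2⁻¹ : ℝ) • A ^ 2
    have hq : Continuous q := by fun_prop
    -- The entrywise mean of the quadratic majorant of `exp (-M i)`. Independence lets it replace `q
    -- (M i)` under the trace, and `W ≤ ρ` as a form then extracts one factor `ρ`. The bound `C`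
    -- serves integrability only.
    let W : Matrix (Fin d) (Fin d) ℝ := fun a b => ∫ ω, q (M i ω) a b ∂μ
    have hHint : ∀ a b, Integrable (fun ω => H ω a b) μ := fun a b =>
      integrable_continuous_comp hSmeas hSC (continuous_exp_neg.matrix_elem a b)
    have hqint : ∀ a b, Integrable (fun ω => q (M i ω) a b) μ := fun a b =>
      integrable_continuous_comp (hmeas i) (hC i) (hq.matrix_elem a b)
    have hmulind : ∀ a b, IndepFun (fun ω => H ω a b) (fun ω => q (M i ω) b a) μ := fun a b =>
      hind.comp (φ := fun A => (NormedSpace.exp (-A) : Matrix (Fin d) (Fin d) ℝ) a b)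
        (ψ := fun A => q A b a)
        (continuous_exp_neg.matrix_elem a b).measurable (hq.matrix_elem b a).measurable
    have hprod : ∀ a b, ∫ ω, H ω a b * q (M i ω) b a ∂μ = ∫ ω, H ω a b * W b a ∂μ := by
      intro a b
      rw [(hmulind a b).integral_fun_mul_eq_mul_integral (hHint a b).aestronglyMeasurable
        (hqint b a).aestronglyMeasurable, integral_mul_const]
    have hprodint : ∀ a b, Integrable (fun ω => H ω a b * q (M i ω) b a) μ := fun a b =>
      (hmulind a b).integrable_mul (hHint a b) (hqint b a)
    have htrace : ∀ A B : Matrix (Fin d) (Fin d) ℝ, (A * B).trace = ∑ a, ∑ b, A a b * B b a :=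
      fun A B => rfl
    have hWmean : ∀ z, 0 ≤ z ⬝ᵥ (ρ • (1 : Matrix (Fin d) (Fin d) ℝ) - W) *ᵥ z := by
      intro z
      have h := hmean i z
      have e : ∫ ω, z ⬝ᵥ (1 - M i ω + (2⁻¹ : ℝ) • M i ω ^ 2) *ᵥ z ∂μ = z ⬝ᵥ W *ᵥ z := by
        simp only [dotProduct_mulVec_eq_sum]
        rw [integral_finsetSum _ fun a _ => integrable_finsetSum _ fun b _ =>
          (hqint a b).mul_const _]
        refine Finset.sum_congr rfl fun a _ => ?_
        rw [integral_finsetSum _ fun b _ => (hqint a b).mul_const _]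
        exact Finset.sum_congr rfl fun b _ => integral_mul_const _ _
      rw [e] at h
      rw [sub_mulVec, dotProduct_sub, smul_mulVec, one_mulVec, dotProduct_smul, smul_eq_mul]
      linarith
    have hstep : ∫ ω, (NormedSpace.exp (-∑ j ∈ insert i s, M j ω)).trace ∂μ ≤
        ∫ ω, (H ω * q (M i ω)).trace ∂μ := by
      refine integral_mono_ae ?_ ?_ ?_
      · refine integrable_continuous_comp (A := fun ω => S ω + M i ω) (C := s.card * C + C)
          (hSmeas.add (hmeas i)) ?_ continuous_exp_neg.matrix_trace |>.congr ?_
        · filter_upwards [hSC, hC i] with ω h1 h2 a b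
          exact (abs_add_le _ _).trans (add_le_add (h1 a b) (h2 a b))
        · refine Filter.Eventually.of_forall fun ω => ?_
          simp only [Finset.sum_insert hi, hS, add_comm]
      · simp only [htrace]
        exact integrable_finsetSum _ fun a _ => integrable_finsetSum _ fun b _ => hprodint a b
      · filter_upwards [hSsymm, hsymm i, hpos i] with ω h1 h2 h3
        simp only [Finset.sum_insert hi]
        rw [neg_add_rev]
        refine (trace_exp_add_le h1.neg h2.neg).trans ?_
        rw [← sub_nonneg, ← trace_sub, ← mul_sub]
        refine trace_exp_mul_nonneg h1.neg fun z => ?_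
        rw [sub_mulVec, dotProduct_sub, sub_nonneg]
        exact dotProduct_exp_neg_le h2 h3 z
    have hfac : ∫ ω, (H ω * q (M i ω)).trace ∂μ = ∫ ω, (H ω * W).trace ∂μ := by
      simp only [htrace]
      rw [integral_finsetSum _ fun a _ => integrable_finsetSum _ fun b _ => hprodint a b,
        integral_finsetSum _ fun a _ => integrable_finsetSum _ fun b _ =>
          (hHint a b).mul_const _]
      refine Finset.sum_congr rfl fun a _ => ?_
      rw [integral_finsetSum _ fun b _ => hprodint a b,
        integral_finsetSum _ fun b _ => (hHint a b).mul_const _]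
      exact Finset.sum_congr rfl fun b _ => hprod a b
    have hHtr : Integrable (fun ω => (H ω).trace) μ :=
      integrable_continuous_comp hSmeas hSC continuous_exp_neg.matrix_trace
    have hlast : ∫ ω, (H ω * W).trace ∂μ ≤ ∫ ω, ρ * (H ω).trace ∂μ := by
      refine integral_mono_ae ?_ (hHtr.const_mul ρ) ?_
      · exact integrable_continuous_comp hSmeas hSC
          (continuous_exp_neg.matrix_mul continuous_const).matrix_trace
      · filter_upwards [hSsymm] with ω h1
        have h := trace_exp_mul_nonneg h1.neg hWmean
        rw [mul_sub, trace_sub, Matrix.mul_smul, mul_one, trace_smul, smul_eq_mul] at h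
        exact sub_nonneg.mp h
    rw [integral_const_mul] at hlast
    rw [Finset.card_insert_of_notMem hi, pow_succ', mul_assoc]
    exact (hstep.trans (hfac.le.trans hlast)).trans (mul_le_mul_of_nonneg_left ih hρ)

end LaplaceTransform

/-! ### Moments of Rademacher sums -/

section SignAverages

variable {ι : Type*} [DecidableEq ι]

/-- The sign vector that equals `-1` exactly on `t`. -/
noncomputable def signVector (t : Finset ι) (i : ι) : ℝ := if i ∈ t then -1 else 1

theorem signVector_mul_self (t : Finset ι) (i : ι) : signVector t i * signVector t i = 1 := by
  unfold signVector; split_ifs <;> norm_num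

theorem sum_powerset_insert_signVector {s : Finset ι} {i : ι} (hi : i ∉ s) (v : ι → ℝ)
    (f : ℝ → ℝ) :
    ∑ t ∈ (insert i s).powerset, f (∑ j ∈ insert i s, signVector t j * v j) =
      ∑ t ∈ s.powerset, (f (∑ j ∈ s, signVector t j * v j + v i) +
        f (∑ j ∈ s, signVector t j * v j - v i)) := by
  rw [Finset.sum_powerset_insert hi, ← Finset.sum_add_distrib]
  refine Finset.sum_congr rfl fun t ht => ?_
  have hit : i ∉ t := fun h => hi (Finset.mem_powerset.mp ht h)
  rw [Finset.sum_insert hi, Finset.sum_insert hi]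
  have h1 : ∑ j ∈ s, signVector (insert i t) j * v j = ∑ j ∈ s, signVector t j * v j := by
    refine Finset.sum_congr rfl fun j hj => ?_
    have hji : j ≠ i := fun h => hi (h ▸ hj)
    simp [signVector, hji]
  rw [h1]
  have h2 : signVector t i = 1 := by simp [signVector, hit]
  have h3 : signVector (insert i t) i = -1 := by simp [signVector]
  rw [h2, h3]
  congr 2 <;> ring

/-- Second, fourth and sixth moments of a Rademacher sum. -/
theorem sign_moments (v : ι → ℝ) (s : Finset ι) :
    ∑ t ∈ s.powerset, (∑ j ∈ s, signVector t j * v j) ^ 2 = 2 ^ s.card * ∑ j ∈ s, v j ^ 2 ∧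
    ∑ t ∈ s.powerset, (∑ j ∈ s, signVector t j * v j) ^ 4 ≤
      2 ^ s.card * (3 * (∑ j ∈ s, v j ^ 2) ^ 2) ∧
    ∑ t ∈ s.powerset, (∑ j ∈ s, signVector t j * v j) ^ 6 ≤
      2 ^ s.card * (15 * (∑ j ∈ s, v j ^ 2) ^ 3) := by
  induction s using Finset.induction_on with
  | empty => simp
  | insert i s hi ih =>
    obtain ⟨h2, h4, h6⟩ := ih
    have h0 : ∑ _t ∈ s.powerset, (1 : ℝ) = 2 ^ s.card := by simp
    rw [sum_powerset_insert_signVector hi v (· ^ 2), sum_powerset_insert_signVector hi v (· ^ 4),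
      sum_powerset_insert_signVector hi v (· ^ 6), Finset.card_insert_of_notMem hi,
      Finset.sum_insert hi]
    set X : Finset ι → ℝ := fun t => ∑ j ∈ s, signVector t j * v j
    set σ := ∑ j ∈ s, v j ^ 2
    set a := v i
    set N : ℝ := 2 ^ s.card
    have hσ : 0 ≤ σ := Finset.sum_nonneg fun j _ => sq_nonneg _
    have hN : 0 < N := by positivity
    have hN2 : (2 : ℝ) ^ (s.card + 1) = 2 * N := pow_succ' 2 _
    -- Averaging over the new sign kills odd powers of `a`; the rest is dominated by the expansions
    -- of `3(σ + a²)²` and `15(σ + a²)³`, where 3 and 15 are the Gaussian moments.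
    have e2 : ∑ t ∈ s.powerset, ((X t + a) ^ 2 + (X t - a) ^ 2) =
        2 * (∑ t ∈ s.powerset, X t ^ 2 + a ^ 2 * ∑ _t ∈ s.powerset, 1) := by
      simp only [Finset.mul_sum, ← Finset.sum_add_distrib]
      exact Finset.sum_congr rfl fun t _ => by ring
    have e4 : ∑ t ∈ s.powerset, ((X t + a) ^ 4 + (X t - a) ^ 4) =
        2 * (∑ t ∈ s.powerset, X t ^ 4 + 6 * a ^ 2 * ∑ t ∈ s.powerset, X t ^ 2 +
          a ^ 4 * ∑ _t ∈ s.powerset, 1) := by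
      simp only [Finset.mul_sum, ← Finset.sum_add_distrib]
      exact Finset.sum_congr rfl fun t _ => by ring
    have e6 : ∑ t ∈ s.powerset, ((X t + a) ^ 6 + (X t - a) ^ 6) =
        2 * (∑ t ∈ s.powerset, X t ^ 6 + 15 * a ^ 2 * ∑ t ∈ s.powerset, X t ^ 4 +
          15 * a ^ 4 * ∑ t ∈ s.powerset, X t ^ 2 + a ^ 6 * ∑ _t ∈ s.powerset, 1) := by
      simp only [Finset.mul_sum, ← Finset.sum_add_distrib]
      exact Finset.sum_congr rfl fun t _ => by ring
    refine ⟨?_, ?_, ?_⟩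
    · refine e2.trans ?_
      rw [h0, h2, hN2]; ring
    · refine e4.trans_le ?_
      rw [h0, h2, hN2]
      have : 0 ≤ N * a ^ 4 := by positivity
      nlinarith
    · refine e6.trans_le ?_
      rw [h0, h2, hN2]
      have q1 : 0 ≤ N * a ^ 6 := by positivity
      have q2 : 0 ≤ N * (σ * a ^ 4) := by positivity
      have q3 := mul_le_mul_of_nonneg_left h4 (by positivity : 0 ≤ 15 * a ^ 2)
      nlinarith

end SignAverages

/-! ### Matrices in the orbit and tangent directions -/

section Orbit

variable {k d : ℕ} {lam : Fin k → ℝ}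

/-- The diagonal of `diagMatrix lam d`. -/
def diagEntries (lam : Fin k → ℝ) (d : ℕ) (i : Fin d) : ℝ :=
  if h : (i : ℕ) < k then lam ⟨i, h⟩ else 0

theorem conjDiag_eq (lam : Fin k → ℝ) (d : ℕ) (O : Matrix.orthogonalGroup (Fin d) ℝ) :
    conjDiag lam d O = (O : Matrix (Fin d) (Fin d) ℝ) * diagonal (diagEntries lam d) *
      (O : Matrix (Fin d) (Fin d) ℝ)ᵀ := rfl

theorem sum_diagEntries_comp (hkd : k ≤ d) (lam : Fin k → ℝ) {f : ℝ → ℝ} (hf : f 0 = 0) :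
    ∑ i, f (diagEntries lam d i) = ∑ i, f (lam i) := by
  obtain ⟨m, rfl⟩ := Nat.exists_eq_add_of_le hkd
  rw [Fin.sum_univ_add]
  simp [diagEntries, hf]

theorem diagEntries_nonneg (hpos : ∀ i, 0 < lam i) (i : Fin d) : 0 ≤ diagEntries lam d i := by
  unfold diagEntries; split_ifs
  · exact (hpos _).le
  · exact le_rfl

theorem diagEntries_le_one (hle : ∀ i, lam i ≤ 1) (i : Fin d) : diagEntries lam d i ≤ 1 := by
  unfold diagEntries; split_ifs
  · exact hle _
  · exact zero_le_one

variable {P : Matrix (Fin d) (Fin d) ℝ}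

theorem isSymm_of_mem_orbitSet (hP : P ∈ orbitSet lam d) : P.IsSymm := by
  obtain ⟨O, rfl⟩ := hP
  rw [conjDiag_eq, IsSymm, transpose_mul, transpose_mul, transpose_transpose, diagonal_transpose,
    mul_assoc]

theorem dotProduct_mulVec_comm_of_isSymm (hP : P.IsSymm) (x z : Fin d → ℝ) :
    x ⬝ᵥ P *ᵥ z = P *ᵥ x ⬝ᵥ z := by
  rw [dotProduct_mulVec, ← mulVec_transpose, hP]

theorem dotProduct_conjDiag_mulVec (O : Matrix.orthogonalGroup (Fin d) ℝ) (x z : Fin d → ℝ) :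
    x ⬝ᵥ conjDiag lam d O *ᵥ z = ∑ i, diagEntries lam d i *
      (((O : Matrix (Fin d) (Fin d) ℝ)ᵀ *ᵥ x) i * ((O : Matrix (Fin d) (Fin d) ℝ)ᵀ *ᵥ z) i) := by
  rw [conjDiag_eq, ← mulVec_mulVec, ← mulVec_mulVec, dotProduct_mulVec, ← mulVec_transpose]
  simp only [dotProduct, mulVec_diagonal]
  exact Finset.sum_congr rfl fun i _ => by ring

theorem dotProduct_mulVec_nonneg_of_mem_orbitSet (hpos : ∀ i, 0 < lam i)
    (hP : P ∈ orbitSet lam d) (z : Fin d → ℝ) : 0 ≤ z ⬝ᵥ P *ᵥ z := by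
  obtain ⟨O, rfl⟩ := hP
  rw [dotProduct_conjDiag_mulVec]
  exact Finset.sum_nonneg fun i _ => mul_nonneg (diagEntries_nonneg hpos i) (mul_self_nonneg _)

/-- Cauchy-Schwarz for the semidefinite form of `P`, in its eigencoordinates. -/
theorem sq_dotProduct_mulVec_le_of_mem_orbitSet (hpos : ∀ i, 0 < lam i)
    (hP : P ∈ orbitSet lam d) (x z : Fin d → ℝ) :
    (x ⬝ᵥ P *ᵥ z) ^ 2 ≤ (x ⬝ᵥ P *ᵥ x) * (z ⬝ᵥ P *ᵥ z) := by
  obtain ⟨O, rfl⟩ := hP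
  simp only [dotProduct_conjDiag_mulVec]
  exact Finset.sum_sq_le_sum_mul_sum_of_sq_le_mul _
    (fun i _ => mul_nonneg (diagEntries_nonneg hpos i) (mul_self_nonneg _))
    (fun i _ => mul_nonneg (diagEntries_nonneg hpos i) (mul_self_nonneg _)) fun i _ => le_of_eq (by ring)

/-- The eigenvalues lie in `[0, 1]`, so `P² ≤ P`. This lowers the degree in `P` from four to three
in the variance estimate. -/
theorem dotProduct_mulVec_self_le_of_mem_orbitSet (hpos : ∀ i, 0 < lam i) (hle : ∀ i, lam i ≤ 1)
    (hP : P ∈ orbitSet lam d) (x : Fin d → ℝ) :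
    P *ᵥ x ⬝ᵥ P *ᵥ x ≤ x ⬝ᵥ P *ᵥ x := by
  have hs := isSymm_of_mem_orbitSet hP
  obtain ⟨O, rfl⟩ := hP
  rw [← dotProduct_mulVec_comm_of_isSymm hs, mulVec_mulVec]
  have hO := transpose_mul_of_mem_orthogonalGroup O.2
  have e : conjDiag lam d O * conjDiag lam d O = (O : Matrix (Fin d) (Fin d) ℝ) *
      diagonal (fun i => diagEntries lam d i * diagEntries lam d i) *
      (O : Matrix (Fin d) (Fin d) ℝ)ᵀ := by
    rw [conjDiag_eq, ← diagonal_mul_diagonal]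
    calc _ = (O : Matrix (Fin d) (Fin d) ℝ) * diagonal (diagEntries lam d) *
          ((O : Matrix (Fin d) (Fin d) ℝ)ᵀ * O) * diagonal (diagEntries lam d) *
          (O : Matrix (Fin d) (Fin d) ℝ)ᵀ := by simp only [mul_assoc]
      _ = _ := by rw [hO, mul_one]; simp only [mul_assoc]
  rw [e, conjDiag_eq, dotProduct_conj_diagonal, dotProduct_conj_diagonal]
  refine Finset.sum_le_sum fun i _ => mul_le_mul_of_nonneg_right ?_ (sq_nonneg _)
  exact mul_le_of_le_one_left (diagEntries_nonneg hpos i) (diagEntries_le_one hle i)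

theorem dotProduct_mulVec_le_of_mem_orbitSet (hle : ∀ i, lam i ≤ 1)
    (hP : P ∈ orbitSet lam d) (x : Fin d → ℝ) : x ⬝ᵥ P *ᵥ x ≤ x ⬝ᵥ x := by
  obtain ⟨O, rfl⟩ := hP
  rw [conjDiag_eq, dotProduct_conj_diagonal, dotProduct_self_eq_sum_sq O.2]
  exact Finset.sum_le_sum fun i _ =>
    mul_le_of_le_one_left (sq_nonneg _) (diagEntries_le_one hle i)

theorem abs_apply_le_one_of_mem_orbitSet (hpos : ∀ i, 0 < lam i) (hle : ∀ i, lam i ≤ 1)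
    (hP : P ∈ orbitSet lam d) (a b : Fin d) : |P a b| ≤ 1 := by
  have h1 := dotProduct_mulVec_self_le_of_mem_orbitSet hpos hle hP (Pi.single b 1)
  have h2 := dotProduct_mulVec_le_of_mem_orbitSet hle hP (Pi.single b 1)
  have h3 : (Pi.single b (1 : ℝ) : Fin d → ℝ) ⬝ᵥ Pi.single b 1 = 1 := by simp
  have h4 : P a b * P a b ≤ P *ᵥ Pi.single b 1 ⬝ᵥ P *ᵥ Pi.single b 1 := by
    rw [mulVec_single_one]
    exact Finset.single_le_sum (f := fun i => P i b * P i b) (fun i _ => mul_self_nonneg _)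
      (Finset.mem_univ a)
  rw [abs_le_one_iff_mul_self_le_one]
  linarith

theorem trace_of_mem_orbitSet (hkd : k ≤ d) (hP : P ∈ orbitSet lam d) :
    P.trace = ∑ i, lam i := by
  obtain ⟨O, rfl⟩ := hP
  rw [conjDiag_eq, trace_mul_comm, ← mul_assoc, transpose_mul_of_mem_orthogonalGroup O.2, one_mul,
    trace_diagonal]
  exact sum_diagEntries_comp hkd lam (f := id) rfl

theorem sum_sq_of_mem_orbitSet (hkd : k ≤ d) (hP : P ∈ orbitSet lam d) :
    ∑ a, ∑ b, P a b ^ 2 = ∑ i, lam i ^ 2 := by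
  have hs := isSymm_of_mem_orbitSet hP
  have e : ∑ a, ∑ b, P a b ^ 2 = (P * P).trace := by
    simp only [trace, diag, mul_apply]
    exact Finset.sum_congr rfl fun a _ => Finset.sum_congr rfl fun b _ => by
      rw [hs.apply a b, pow_two]
  rw [e]
  obtain ⟨O, rfl⟩ := hP
  have hO := transpose_mul_of_mem_orthogonalGroup O.2
  rw [conjDiag_eq]
  calc _ = ((O : Matrix (Fin d) (Fin d) ℝ) * (diagonal (diagEntries lam d) *
          ((O : Matrix (Fin d) (Fin d) ℝ)ᵀ * O) * diagonal (diagEntries lam d) *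
          (O : Matrix (Fin d) (Fin d) ℝ)ᵀ)).trace := by simp only [mul_assoc]
    _ = _ := by
      rw [hO, mul_one, trace_mul_comm, mul_assoc, hO, mul_one, diagonal_mul_diagonal,
        trace_diagonal, ← sum_diagEntries_comp hkd lam (f := fun t => t ^ 2) (by simp)]
      exact Finset.sum_congr rfl fun i _ => by ring

theorem hsInner_tangent (hP : P.IsSymm) (x z : Fin d → ℝ) :
    hsInner P (vecMulVec x z + vecMulVec z x) = 2 * (x ⬝ᵥ P *ᵥ z) := by
  have h : ∀ u v : Fin d → ℝ, (P * vecMulVec u v).trace = v ⬝ᵥ P *ᵥ u := fun u v => by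
    rw [mul_vecMulVec, trace_vecMulVec, dotProduct_comm]
  rw [hsInner, transpose_add, transpose_vecMulVec, transpose_vecMulVec, mul_add, trace_add, h, h,
    dotProduct_mulVec_comm_of_isSymm hP z x, dotProduct_comm]
  ring

theorem hsInner_vecMulVec_self (P : Matrix (Fin d) (Fin d) ℝ) (x : Fin d → ℝ) :
    hsInner P (vecMulVec x x) = x ⬝ᵥ P *ᵥ x := by
  rw [hsInner, transpose_vecMulVec, mul_vecMulVec, trace_vecMulVec, dotProduct_comm]

theorem hsInner_one (P : Matrix (Fin d) (Fin d) ℝ) : hsInner P 1 = P.trace := by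
  rw [hsInner, transpose_one, mul_one]

theorem hsInner_comm (X Y : Matrix (Fin d) (Fin d) ℝ) : hsInner X Y = hsInner Y X := by
  rw [hsInner, hsInner, ← trace_transpose, transpose_mul, transpose_transpose]

theorem isSymm_tangent (x z : Fin d → ℝ) : (vecMulVec x z + vecMulVec z x).IsSymm := by
  rw [IsSymm, transpose_add, transpose_vecMulVec, transpose_vecMulVec, add_comm]

theorem trace_tangent (x z : Fin d → ℝ) :
    (vecMulVec x z + vecMulVec z x).trace = 2 * (x ⬝ᵥ z) := by
  rw [trace_add, trace_vecMulVec, trace_vecMulVec, dotProduct_comm z x]; ring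

theorem hsInner_tangent_self (x z : Fin d → ℝ) :
    hsInner (vecMulVec x z + vecMulVec z x) (vecMulVec x z + vecMulVec z x) =
      2 * ((x ⬝ᵥ x) * (z ⬝ᵥ z) + (x ⬝ᵥ z) ^ 2) := by
  rw [hsInner_tangent (isSymm_tangent x z), add_mulVec, vecMulVec_mulVec, vecMulVec_mulVec,
    dotProduct_add]
  simp only [op_smul_eq_smul, dotProduct_smul, smul_eq_mul]
  ring

end Orbit

/-! ### Second and third moments of the invariant measure -/

section Haar

variable {k d : ℕ} {lam : Fin k → ℝ}

instance instIsProbabilityMeasureHaarOrthogonal (d : ℕ) :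
    IsProbabilityMeasure (haarOrthogonal d) :=
  ⟨Measure.haarMeasure_self⟩

theorem conjDiag_mul (lam : Fin k → ℝ) (V O : Matrix.orthogonalGroup (Fin d) ℝ) :
    conjDiag lam d (V * O) = (V : Matrix (Fin d) (Fin d) ℝ) * conjDiag lam d O *
      (V : Matrix (Fin d) (Fin d) ℝ)ᵀ := by
  simp only [conjDiag, Submonoid.coe_mul, transpose_mul, mul_assoc]

theorem continuous_conjDiag (lam : Fin k → ℝ) (d : ℕ) : Continuous (conjDiag lam d) := by
  unfold conjDiag
  fun_prop

theorem conjDiag_mem_orbitSet (O : Matrix.orthogonalGroup (Fin d) ℝ) :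
    conjDiag lam d O ∈ orbitSet lam d := ⟨O, rfl⟩

/-- The distribution of `conjDiag` under Haar measure is invariant under orthogonal conjugation. -/
theorem integral_conjDiag_conj (lam : Fin k → ℝ) {V : Matrix (Fin d) (Fin d) ℝ}
    (hV : V ∈ Matrix.orthogonalGroup (Fin d) ℝ) (f : Matrix (Fin d) (Fin d) ℝ → ℝ) :
    ∫ O, f (V * conjDiag lam d O * Vᵀ) ∂haarOrthogonal d =
      ∫ O, f (conjDiag lam d O) ∂haarOrthogonal d := by
  have : (haarOrthogonal d).IsMulLeftInvariant := by unfold haarOrthogonal; infer_instance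
  rw [← integral_mul_left_eq_self (fun O => f (conjDiag lam d O)) ⟨V, hV⟩]
  simp only [conjDiag_mul]

theorem integrable_comp_conjDiag (lam : Fin k → ℝ) {f : Matrix (Fin d) (Fin d) ℝ → ℝ}
    (hf : Continuous f) : Integrable (fun O => f (conjDiag lam d O)) (haarOrthogonal d) := by
  have hc := hf.comp (continuous_conjDiag lam d)
  obtain ⟨B, hB⟩ := isCompact_univ.exists_bound_of_continuousOn hc.continuousOn
  exact Integrable.of_bound hc.measurable.aestronglyMeasurable B
    (Filter.Eventually.of_forall fun O => hB O trivial)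

theorem continuous_hsInner_left (X : Matrix (Fin d) (Fin d) ℝ) :
    Continuous fun P : Matrix (Fin d) (Fin d) ℝ => hsInner P X :=
  (continuous_id.matrix_mul continuous_const).matrix_trace

theorem orbitTraceMoment_eq (lam : Fin k → ℝ) (d t : ℕ) (X : Matrix (Fin d) (Fin d) ℝ) :
    orbitTraceMoment lam d t X = ∫ O, hsInner (conjDiag lam d O) X ^ t ∂haarOrthogonal d := by
  have hc : Continuous fun P : Matrix (Fin d) (Fin d) ℝ => hsInner P X ^ t :=
    (continuous_hsInner_left X).pow t
  exact integral_map (continuous_conjDiag lam d).measurable.aemeasurable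
    hc.measurable.aestronglyMeasurable

theorem dotProduct_conj_mulVec (V P : Matrix (Fin d) (Fin d) ℝ) (x z : Fin d → ℝ) :
    x ⬝ᵥ (V * P * Vᵀ) *ᵥ z = (Vᵀ *ᵥ x) ⬝ᵥ P *ᵥ (Vᵀ *ᵥ z) := by
  rw [← mulVec_mulVec, ← mulVec_mulVec, dotProduct_mulVec, ← mulVec_transpose]

theorem submatrix_one_mem_orthogonalGroup (σ : Equiv.Perm (Fin d)) :
    (1 : Matrix (Fin d) (Fin d) ℝ).submatrix σ id ∈ Matrix.orthogonalGroup (Fin d) ℝ := by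
  rw [Matrix.mem_orthogonalGroup_iff, transpose_submatrix, transpose_one,
    ← submatrix_mul _ _ _ id _ Function.bijective_id, one_mul, submatrix_one_equiv]

theorem integral_conjDiag_perm (lam : Fin k → ℝ) (σ : Equiv.Perm (Fin d)) (i j : Fin d) :
    ∫ O, conjDiag lam d O (σ i) (σ i) * conjDiag lam d O (σ j) (σ j) ∂haarOrthogonal d =
      ∫ O, conjDiag lam d O i i * conjDiag lam d O j j ∂haarOrthogonal d := by
  rw [← integral_conjDiag_conj lam (submatrix_one_mem_orthogonalGroup σ)
    fun P => P i i * P j j]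
  have h : ∀ P : Matrix (Fin d) (Fin d) ℝ, (1 : Matrix (Fin d) (Fin d) ℝ).submatrix σ id * P *
      ((1 : Matrix (Fin d) (Fin d) ℝ).submatrix σ id)ᵀ = P.submatrix σ σ := by
    intro P
    conv_lhs => rw [← submatrix_id_id P]
    rw [transpose_submatrix, transpose_one, ← submatrix_mul _ _ _ id _ Function.bijective_id,
      ← submatrix_mul _ _ _ id _ Function.bijective_id, one_mul, mul_one]
  simp only [h, submatrix_apply]

/-- The second trace moment of the invariant measure is an invariant quadratic form on symmetric
matrices, hence a combination of the squared Frobenius norm and the squared trace. -/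
theorem exists_second_moment (hpos : ∀ i, 0 < lam i) (hd : 2 ≤ d) :
    ∃ D β : ℝ, 0 ≤ β ∧ ∀ X : Matrix (Fin d) (Fin d) ℝ, X.IsSymm →
      ∫ O, hsInner (conjDiag lam d O) X ^ 2 ∂haarOrthogonal d =
        D * hsInner X X + β * X.trace ^ 2 := by
  let i₀ : Fin d := ⟨0, by omega⟩
  let i₁ : Fin d := ⟨1, by omega⟩
  have h01 : i₀ ≠ i₁ := by simp [i₀, i₁]
  -- After diagonalizing `X`, only mixed moments of diagonal entries of the orbit matrix matter.
  -- Permutation invariance leaves two values: one for `i = j` and, by 2-transitivity, one for `i ≠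
  -- j`.
  let E : Fin d → Fin d → ℝ := fun i j =>
    ∫ O, conjDiag lam d O i i * conjDiag lam d O j j ∂haarOrthogonal d
  have hdiag : ∀ i, E i i = E i₀ i₀ := fun i => by
    have h := integral_conjDiag_perm lam (Equiv.swap i₀ i) i₀ i₀
    rwa [Equiv.swap_apply_left] at h
  have hoff : ∀ i j, i ≠ j → E i j = E i₀ i₁ := fun i j hij => by
    obtain ⟨σ, h0, h1⟩ := MulAction.is_two_pretransitive_iff.mp
      (Equiv.Perm.isMultiplyPretransitive (Fin d) 2) h01 hij
    have h := integral_conjDiag_perm lam σ i₀ i₁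
    rw [Equiv.Perm.smul_def] at h0 h1
    rwa [h0, h1] at h
  refine ⟨E i₀ i₀ - E i₀ i₁, E i₀ i₁, ?_, fun X hX => ?_⟩
  · refine integral_nonneg fun O => mul_nonneg ?_ ?_
    · simpa using dotProduct_mulVec_nonneg_of_mem_orbitSet hpos
        (conjDiag_mem_orbitSet (lam := lam) O) (Pi.single i₀ 1)
    · simpa using dotProduct_mulVec_nonneg_of_mem_orbitSet hpos
        (conjDiag_mem_orbitSet (lam := lam) O) (Pi.single i₁ 1)
  · obtain ⟨V, hV, v, rfl⟩ := exists_orthogonal_diagonalization hX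
    have hVV := transpose_mul_of_mem_orthogonalGroup hV
    have hX2 : hsInner (V * diagonal v * Vᵀ) (V * diagonal v * Vᵀ) = ∑ i, v i ^ 2 := by
      rw [hsInner, hX, show V * diagonal v * Vᵀ * (V * diagonal v * Vᵀ) =
        V * (diagonal v * (Vᵀ * V) * diagonal v * Vᵀ) by simp only [mul_assoc], hVV, mul_one,
        trace_mul_comm, mul_assoc, hVV, mul_one, diagonal_mul_diagonal, trace_diagonal]
      simp only [pow_two]
    have hXt : (V * diagonal v * Vᵀ).trace = ∑ i, v i := by
      rw [trace_mul_comm, ← mul_assoc, hVV, one_mul, trace_diagonal]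
    rw [hX2, hXt, ← integral_conjDiag_conj lam hV
      fun P => hsInner P (V * diagonal v * Vᵀ) ^ 2]
    have hin : ∀ Q : Matrix (Fin d) (Fin d) ℝ,
        hsInner (V * Q * Vᵀ) (V * diagonal v * Vᵀ) = ∑ i, Q i i * v i := by
      intro Q
      rw [hsInner, hX, show V * Q * Vᵀ * (V * diagonal v * Vᵀ) =
        V * (Q * (Vᵀ * V) * diagonal v * Vᵀ) by simp only [mul_assoc], hVV, mul_one,
        trace_mul_comm, mul_assoc, hVV, mul_one]
      simp [trace, mul_diagonal]
    have hint : ∀ i j, Integrable (fun O => conjDiag lam d O i i * conjDiag lam d O j j *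
        (v i * v j)) (haarOrthogonal d) := fun i j =>
      integrable_comp_conjDiag lam (f := fun P => P i i * P j j * (v i * v j)) (by fun_prop)
    have e1 : ∫ O, hsInner (V * conjDiag lam d O * Vᵀ) (V * diagonal v * Vᵀ) ^ 2
        ∂haarOrthogonal d = ∑ i, ∑ j, E i j * (v i * v j) := by
      have : ∀ O, hsInner (V * conjDiag lam d O * Vᵀ) (V * diagonal v * Vᵀ) ^ 2 =
          ∑ i, ∑ j, conjDiag lam d O i i * conjDiag lam d O j j * (v i * v j) := fun O => by
        rw [hin, pow_two, Finset.sum_mul_sum]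
        exact Finset.sum_congr rfl fun i _ => Finset.sum_congr rfl fun j _ => by ring
      simp only [this]
      rw [integral_finsetSum _ fun i _ => integrable_finsetSum _ fun j _ => hint i j]
      refine Finset.sum_congr rfl fun i _ => ?_
      rw [integral_finsetSum _ fun j _ => hint i j]
      exact Finset.sum_congr rfl fun j _ => integral_mul_const _ _
    rw [e1, pow_two (∑ i, v i), Finset.sum_mul_sum, Finset.mul_sum, Finset.mul_sum,
      ← Finset.sum_add_distrib]
    refine Finset.sum_congr rfl fun i _ => ?_
    have e2 : ∀ j, E i j * (v i * v j) =
        (if j = i then (E i₀ i₀ - E i₀ i₁) * v i ^ 2 else 0) + E i₀ i₁ * (v i * v j) := by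
      intro j
      split_ifs with h
      · subst h; rw [hdiag j]; ring
      · rw [hoff i j (Ne.symm h)]; ring
    simp only [e2, Finset.sum_add_distrib, Finset.sum_ite_eq', Finset.mem_univ, if_true,
      Finset.mul_sum]

/-- The coefficients `D` and `β` are tied by two identities: testing on the identity gives the
squared trace, and summing over all matrix entries gives the squared Frobenius norm. Solving for `D`
gives the bound. -/
theorem le_integral_sq_dotProduct (hpos : ∀ i, 0 < lam i) (hkd : k < d) (hk : 1 ≤ k)
    (x z : Fin d → ℝ) :
    (∑ i, lam i ^ 2) / (2 * (k + 1)) / d ^ 2 * ((x ⬝ᵥ x) * (z ⬝ᵥ z)) ≤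
      ∫ O, (x ⬝ᵥ conjDiag lam d O *ᵥ z) ^ 2 ∂haarOrthogonal d := by
  obtain ⟨D, β, hβ, hF⟩ := exists_second_moment (lam := lam) hpos (d := d) (by omega)
  have hG : ∀ x z : Fin d → ℝ, ∫ O, (x ⬝ᵥ conjDiag lam d O *ᵥ z) ^ 2 ∂haarOrthogonal d =
      D / 2 * ((x ⬝ᵥ x) * (z ⬝ᵥ z) + (x ⬝ᵥ z) ^ 2) + β * (x ⬝ᵥ z) ^ 2 := by
    intro x z
    have h := hF _ (isSymm_tangent x z)
    rw [hsInner_tangent_self, trace_tangent] at h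
    simp only [hsInner_tangent (isSymm_of_mem_orbitSet (conjDiag_mem_orbitSet _)), mul_pow,
      integral_const_mul] at h
    linarith
  set N := ∑ i, lam i ^ 2 with hN
  set T := ∑ i, lam i with hT
  have hTr : T ^ 2 = D * d + β * d ^ 2 := by
    have h := hF 1 isSymm_one
    simp only [hsInner_one, trace_of_mem_orbitSet hkd.le (conjDiag_mem_orbitSet _), trace_one,
      Fintype.card_fin] at h
    simpa using h
  have hsum : N = D / 2 * (d ^ 2 + d) + β * d := by
    have h1 : ∫ O, ∑ a, ∑ b, conjDiag lam d O a b ^ 2 ∂haarOrthogonal d = N := by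
      simp only [sum_sq_of_mem_orbitSet hkd.le (conjDiag_mem_orbitSet _)]
      simp [hN]
    have hint : ∀ a b, Integrable (fun O => conjDiag lam d O a b ^ 2) (haarOrthogonal d) :=
      fun a b => integrable_comp_conjDiag lam (f := fun P => P a b ^ 2) (by fun_prop)
    rw [← h1, integral_finsetSum _ fun a _ => integrable_finsetSum _ fun b _ => hint a b]
    have h2 : ∀ a b : Fin d, ∫ O, conjDiag lam d O a b ^ 2 ∂haarOrthogonal d =
        D / 2 + if a = b then D / 2 + β else 0 := by
      intro a b
      have h := hG (Pi.single a 1) (Pi.single b 1)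
      simp only [single_one_dotProduct, mulVec_single_one, col_apply] at h
      rw [h]
      by_cases hab : a = b
      · subst hab; simp; ring
      · simp [hab]
    have h3 : ∀ a : Fin d, ∫ O, ∑ b, conjDiag lam d O a b ^ 2 ∂haarOrthogonal d =
        d * (D / 2) + (D / 2 + β) := fun a => by
      rw [integral_finsetSum _ fun b _ => hint a b]
      simp only [h2, Finset.sum_add_distrib, Finset.sum_ite_eq, Finset.mem_univ, if_true]
      simp
    simp only [h3]
    simp
    ring
  have hCS : T ^ 2 ≤ k * N := by
    have := sq_sum_le_card_mul_sum_sq (s := Finset.univ) (f := lam)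
    simpa using this
  have hdk : (k : ℝ) + 1 ≤ d := by exact_mod_cast hkd
  have hk1 : (1 : ℝ) ≤ k := by exact_mod_cast hk
  have hd0 : (0 : ℝ) < d := by linarith
  have hN0 : 0 ≤ N := Finset.sum_nonneg fun i _ => sq_nonneg _
  -- Eliminating `β` leaves `N - T²/d`. Here `d ≥ k + 1` is essential: with `T² ≤ kN` it keeps a
  -- fraction `1/(k + 1)` of `N`, whereas scalar orbit matrices would give zero.
  have hD : N / (k + 1) ≤ D / 2 * (d ^ 2 + d - 2) := by
    have h1 : D / 2 * (d ^ 2 + d - 2) = N - T ^ 2 / d := by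
      rw [hTr, hsum]; field_simp; ring
    rw [h1]
    have h2 : T ^ 2 / d ≤ k * N / (k + 1) := by
      gcongr
    have h3 : N / (k + 1) = N - k * N / (k + 1) := by field_simp; ring
    linarith
  have hD2 : N / (2 * (k + 1)) / d ^ 2 ≤ D / 2 := by
    rw [div_le_iff₀ (by positivity)]
    have h4 : 0 ≤ D := by
      by_contra! hneg
      have : D / 2 * ((d : ℝ) ^ 2 + d - 2) < 0 :=
        mul_neg_of_neg_of_pos (by linarith) (by nlinarith)
      have : 0 ≤ N / (k + 1) := by positivity
      linarith
    have h5 : N / (2 * (k + 1)) = N / (k + 1) / 2 := by field_simp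
    rw [h5]
    nlinarith [mul_nonneg h4 (by nlinarith : (0 : ℝ) ≤ 2 * d ^ 2 - (d ^ 2 + d - 2))]
  have hD0 : 0 ≤ D / 2 := le_trans (by positivity) hD2
  have hxx : 0 ≤ x ⬝ᵥ x := Finset.sum_nonneg fun i _ => mul_self_nonneg _
  have hzz : 0 ≤ z ⬝ᵥ z := Finset.sum_nonneg fun i _ => mul_self_nonneg _
  rw [hG]
  have h6 := mul_le_mul_of_nonneg_right hD2 (mul_nonneg hxx hzz)
  have h7 := mul_nonneg hD0 (sq_nonneg (x ⬝ᵥ z))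
  have h8 := mul_nonneg hβ (sq_nonneg (x ⬝ᵥ z))
  linarith

/-- Vectors of equal length are exchanged by a Householder reflection. -/
theorem exists_orthogonal_mulVec_eq {x y : Fin d → ℝ} (hxy : x ⬝ᵥ x = y ⬝ᵥ y) :
    ∃ V ∈ Matrix.orthogonalGroup (Fin d) ℝ, V *ᵥ x = y := by
  by_cases hne : x = y
  · exact ⟨1, one_mem _, by rw [one_mulVec, hne]⟩
  set v := x - y with hv
  set r := v ⬝ᵥ v with hr
  have hr0 : r ≠ 0 := by
    rw [hr, Ne, dotProduct_self_eq_zero, hv, sub_eq_zero]; exact hne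
  let V : Matrix (Fin d) (Fin d) ℝ := 1 - (2 / r) • vecMulVec v v
  have hVs : Vᵀ = V := by
    simp only [V, transpose_sub, transpose_one, transpose_smul, transpose_vecMulVec]
  refine ⟨V, ?_, ?_⟩
  · rw [Matrix.mem_orthogonalGroup_iff, hVs]
    have h1 : vecMulVec v v * vecMulVec v v = r • vecMulVec v v := by
      rw [vecMulVec_mul_vecMulVec, vecMulVec_smul]
    simp only [V, sub_mul, mul_sub, one_mul, mul_one, Matrix.smul_mul, Matrix.mul_smul, h1,
      smul_smul]
    have h2 : 2 / r * (2 / r * r) = 2 / r + 2 / r := by field_simp; norm_num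
    rw [h2, add_smul]
    abel
  · have h1 : v ⬝ᵥ x = r / 2 := by
      have : r = 2 * (v ⬝ᵥ x) := by
        simp only [hr, hv, sub_dotProduct, dotProduct_sub, dotProduct_comm y x, hxy]
        ring
      rw [this]; ring
    simp only [V, sub_mulVec, one_mulVec, smul_mulVec, vecMulVec_mulVec, op_smul_eq_smul, h1,
      smul_smul]
    rw [show 2 / r * (r / 2) = 1 by field_simp, one_smul, hv]
    abel

theorem integral_cube_congr (lam : Fin k → ℝ) {x y : Fin d → ℝ} (hxy : x ⬝ᵥ x = y ⬝ᵥ y) :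
    ∫ O, (x ⬝ᵥ conjDiag lam d O *ᵥ x) ^ 3 ∂haarOrthogonal d =
      ∫ O, (y ⬝ᵥ conjDiag lam d O *ᵥ y) ^ 3 ∂haarOrthogonal d := by
  obtain ⟨V, hV, rfl⟩ := exists_orthogonal_mulVec_eq hxy
  have hVt : Vᵀ ∈ Matrix.orthogonalGroup (Fin d) ℝ := by
    rw [Matrix.mem_orthogonalGroup_iff, transpose_transpose,
      transpose_mul_of_mem_orthogonalGroup hV]
  rw [← integral_conjDiag_conj lam hVt fun P => (x ⬝ᵥ P *ᵥ x) ^ 3]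
  simp only [dotProduct_conj_mulVec]
  simp only [transpose_transpose]

/-- The form is a combination of squares of Rademacher sums along the orthonormal columns of `O`.
Jensen with weights `λ_i / T` moves the cube inside, and each sixth moment is at most 15. -/
theorem sum_sign_cube_le (hpos : ∀ i, 0 < lam i) (hk : 1 ≤ k) (hkd : k ≤ d)
    (O : Matrix.orthogonalGroup (Fin d) ℝ) :
    ∑ t ∈ (Finset.univ : Finset (Fin d)).powerset,
      (signVector t ⬝ᵥ conjDiag lam d O *ᵥ signVector t) ^ 3 ≤
      2 ^ d * (15 * (∑ i, lam i) ^ 3) := by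
  set T := ∑ i, lam i with hT
  have hne : (Finset.univ : Finset (Fin k)).Nonempty := ⟨⟨0, hk⟩, Finset.mem_univ _⟩
  have hT0 : 0 < T := Finset.sum_pos (fun i _ => hpos i) hne
  have hsumD : ∑ i, diagEntries lam d i = T := sum_diagEntries_comp hkd lam (f := id) rfl
  set U : Matrix (Fin d) (Fin d) ℝ := (O : Matrix (Fin d) (Fin d) ℝ) with hU
  have hcol : ∀ i, ∑ j, U j i ^ 2 = 1 := fun i => by
    have h := congrFun (congrFun (transpose_mul_of_mem_orthogonalGroup O.2) i) i
    rw [one_apply_eq, mul_apply] at h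
    simpa [pow_two] using h
  have hcoord : ∀ t i, (Uᵀ *ᵥ signVector t) i = ∑ j, signVector t j * U j i := fun t i => by
    simp only [mulVec, dotProduct, transpose_apply]
    exact Finset.sum_congr rfl fun j _ => mul_comm _ _
  have hpt : ∀ t : Finset (Fin d), (signVector t ⬝ᵥ conjDiag lam d O *ᵥ signVector t) ^ 3 ≤
      ∑ i, T ^ 2 * diagEntries lam d i * (∑ j, signVector t j * U j i) ^ 6 := by
    intro t
    have h := Real.pow_arith_mean_le_arith_mean_pow Finset.univ
      (fun i => diagEntries lam d i / T) (fun i => (∑ j, signVector t j * U j i) ^ 2)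
      (fun i _ => div_nonneg (diagEntries_nonneg hpos i) hT0.le)
      (by rw [← Finset.sum_div, hsumD, div_self hT0.ne']) (fun i _ => sq_nonneg _) 3
    have h2 := mul_le_mul_of_nonneg_left h (pow_pos hT0 3).le
    rw [← mul_pow, Finset.mul_sum, Finset.mul_sum] at h2
    have e1 : signVector t ⬝ᵥ conjDiag lam d O *ᵥ signVector t =
        ∑ i, T * (diagEntries lam d i / T * (∑ j, signVector t j * U j i) ^ 2) := by
      rw [dotProduct_conjDiag_mulVec]
      refine Finset.sum_congr rfl fun i _ => ?_
      rw [← hU, hcoord]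
      field_simp
    have e2 : ∀ i, T ^ 2 * diagEntries lam d i * (∑ j, signVector t j * U j i) ^ 6 =
        T ^ 3 * (diagEntries lam d i / T * ((∑ j, signVector t j * U j i) ^ 2) ^ 3) := by
      intro i
      field_simp
    rw [e1]
    simp only [e2]
    exact h2
  refine (Finset.sum_le_sum fun t _ => hpt t).trans ?_
  rw [Finset.sum_comm]
  have hcolsum : ∀ i, ∑ t ∈ (Finset.univ : Finset (Fin d)).powerset,
      T ^ 2 * diagEntries lam d i * (∑ j, signVector t j * U j i) ^ 6 ≤
      T ^ 2 * diagEntries lam d i * (2 ^ d * 15) := by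
    intro i
    rw [← Finset.mul_sum]
    refine mul_le_mul_of_nonneg_left ?_ (mul_nonneg (sq_nonneg _) (diagEntries_nonneg hpos i))
    have h := (sign_moments (fun j => U j i) Finset.univ).2.2
    rw [hcol] at h
    simpa using h
  refine (Finset.sum_le_sum fun i _ => hcolsum i).trans (le_of_eq ?_)
  rw [← Finset.sum_mul, ← Finset.mul_sum, hsumD]
  ring

/-- By invariance the moment depends only on the length of the vector. Sign vectors have squared
length `d`, so averaging over them gives the moment at `x` times `d³`, bounded pointwise in `O`. -/
theorem integral_cube_le (hpos : ∀ i, 0 < lam i) (hk : 1 ≤ k) (hkd : k ≤ d)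
    {x : Fin d → ℝ} (hx : x ⬝ᵥ x = 1) :
    ∫ O, (x ⬝ᵥ conjDiag lam d O *ᵥ x) ^ 3 ∂haarOrthogonal d ≤
      15 * (∑ i, lam i) ^ 3 / d ^ 3 := by
  have hd0 : (0 : ℝ) < d := by exact_mod_cast (by omega : 0 < d)
  have hint : ∀ y : Fin d → ℝ, Integrable
      (fun O => (y ⬝ᵥ conjDiag lam d O *ᵥ y) ^ 3) (haarOrthogonal d) := fun y =>
    integrable_comp_conjDiag lam (f := fun P => (y ⬝ᵥ P *ᵥ y) ^ 3) (by fun_prop)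
  have hsign : ∀ t : Finset (Fin d),
      ∫ O, (signVector t ⬝ᵥ conjDiag lam d O *ᵥ signVector t) ^ 3 ∂haarOrthogonal d =
        d ^ 3 * ∫ O, (x ⬝ᵥ conjDiag lam d O *ᵥ x) ^ 3 ∂haarOrthogonal d := by
    intro t
    have hlen : signVector t ⬝ᵥ signVector t = (√d • x) ⬝ᵥ (√d • x) := by
      simp only [dotProduct_smul, smul_dotProduct, hx, smul_eq_mul, mul_one,
        Real.mul_self_sqrt hd0.le]
      simp [dotProduct, signVector_mul_self]
    rw [integral_cube_congr lam hlen, ← integral_const_mul]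
    refine integral_congr_ae (Filter.Eventually.of_forall fun O => ?_)
    simp only [mulVec_smul, dotProduct_smul, smul_dotProduct, smul_eq_mul, ← mul_assoc,
      Real.mul_self_sqrt hd0.le, mul_pow]
  have h1 : ∫ O, ∑ t ∈ (Finset.univ : Finset (Fin d)).powerset,
      (signVector t ⬝ᵥ conjDiag lam d O *ᵥ signVector t) ^ 3 ∂haarOrthogonal d ≤
      2 ^ d * (15 * (∑ i, lam i) ^ 3) := by
    have h := integral_mono (integrable_finsetSum _ fun t _ => hint _) (integrable_const _)
      (fun O => sum_sign_cube_le hpos hk hkd O) (μ := haarOrthogonal d)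
    simpa using h
  rw [integral_finsetSum _ fun t _ => hint _] at h1
  simp only [hsign, Finset.sum_const, Finset.card_powerset, Finset.card_univ, Fintype.card_fin,
    nsmul_eq_mul, Nat.cast_pow, Nat.cast_ofNat] at h1
  rw [le_div_iff₀ (by positivity)]
  have h2 := le_of_mul_le_mul_left h1 (by positivity : (0 : ℝ) < 2 ^ d)
  linarith

theorem integral_mul_sq_le (hpos : ∀ i, 0 < lam i) (hk : 1 ≤ k) (hkd : k ≤ d)
    {x : Fin d → ℝ} (hx : x ⬝ᵥ x = 1) (z : Fin d → ℝ) :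
    ∫ O, (x ⬝ᵥ conjDiag lam d O *ᵥ x) * (x ⬝ᵥ conjDiag lam d O *ᵥ z) ^ 2 ∂haarOrthogonal d ≤
      15 * (∑ i, lam i) ^ 3 / d ^ 3 * (z ⬝ᵥ z) := by
  have hunit : ∀ w : Fin d → ℝ, w ⬝ᵥ w = 1 →
      ∫ O, (x ⬝ᵥ conjDiag lam d O *ᵥ x) * (x ⬝ᵥ conjDiag lam d O *ᵥ w) ^ 2 ∂haarOrthogonal d ≤
        15 * (∑ i, lam i) ^ 3 / d ^ 3 := by
    intro w hw
    have h1 := integral_cube_le (lam := lam) hpos hk hkd hx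
    have h2 := integral_cube_le (lam := lam) hpos hk hkd hw
    have i1 := integrable_comp_conjDiag lam (f := fun P => (x ⬝ᵥ P *ᵥ x) ^ 3) (by fun_prop)
    have i2 := integrable_comp_conjDiag lam (f := fun P => (w ⬝ᵥ P *ᵥ w) ^ 3) (by fun_prop)
    have h3 := integral_mono
      (integrable_comp_conjDiag lam (f := fun P => (x ⬝ᵥ P *ᵥ x) * (x ⬝ᵥ P *ᵥ w) ^ 2) (by fun_prop))
      ((i1.const_mul (2 / 3)).add (i2.const_mul (1 / 3))) (μ := haarOrthogonal d) (fun O => by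
        have hO := conjDiag_mem_orbitSet (lam := lam) O
        have p1 := dotProduct_mulVec_nonneg_of_mem_orbitSet hpos hO x
        have p2 := dotProduct_mulVec_nonneg_of_mem_orbitSet hpos hO w
        have p3 := sq_dotProduct_mulVec_le_of_mem_orbitSet hpos hO x w
        have p4 := mul_le_mul_of_nonneg_left p3 p1
        simp only [Pi.add_apply]
        refine p4.trans ?_
        set a := x ⬝ᵥ conjDiag lam d O *ᵥ x
        set b := w ⬝ᵥ conjDiag lam d O *ᵥ w
        -- The inequality `3a²b ≤ 2a³ + b³`, as the difference is `(2a + b)(a - b)²`.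
        nlinarith [mul_nonneg (add_nonneg (add_nonneg p1 p1) p2) (sq_nonneg (a - b))])
    rw [integral_add' (i1.const_mul _) (i2.const_mul _), integral_const_mul,
      integral_const_mul] at h3
    linarith
  by_cases hz : z = 0
  · simp [hz]
  have hzz : 0 < z ⬝ᵥ z := lt_of_le_of_ne (Finset.sum_nonneg fun i _ => mul_self_nonneg _)
    (Ne.symm (mt dotProduct_self_eq_zero.mp hz))
  set r := √(z ⬝ᵥ z) with hr
  have hr0 : 0 < r := Real.sqrt_pos.mpr hzz
  have hrr : r * r = z ⬝ᵥ z := Real.mul_self_sqrt hzz.le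
  have hw := hunit (r⁻¹ • z) (by
    simp only [dotProduct_smul, smul_dotProduct, smul_eq_mul, ← hrr]
    field_simp)
  have e : ∀ O : Matrix.orthogonalGroup (Fin d) ℝ,
      (x ⬝ᵥ conjDiag lam d O *ᵥ x) * (x ⬝ᵥ conjDiag lam d O *ᵥ (r⁻¹ • z)) ^ 2 =
      (z ⬝ᵥ z)⁻¹ * ((x ⬝ᵥ conjDiag lam d O *ᵥ x) * (x ⬝ᵥ conjDiag lam d O *ᵥ z) ^ 2) := by
    intro O
    rw [← hrr, mulVec_smul, dotProduct_smul, smul_eq_mul]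
    field_simp
  simp only [e, integral_const_mul] at hw
  rwa [inv_mul_le_iff₀ hzz, mul_comm] at hw

end Haar

/-! ### Transfer of moments to random cubatures -/

section Cubature

variable {k d : ℕ} {lam : Fin k → ℝ} {Ω Ω' : Type*} [MeasurableSpace Ω] [MeasurableSpace Ω']
  {μ : Measure Ω} {μ' : Measure Ω'}

theorem measurableSet_orbitSet (lam : Fin k → ℝ) (d : ℕ) : MeasurableSet (orbitSet lam d) :=
  (isCompact_range (continuous_conjDiag lam d)).isClosed.measurableSet

theorem IsRandomCubature.of_identDistrib {t : ℕ} {P : Ω → Matrix (Fin d) (Fin d) ℝ}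
    {Q : Ω' → Matrix (Fin d) (Fin d) ℝ} (hQ : IsRandomCubature lam d t Q μ')
    (h : IdentDistrib P Q μ μ') : IsRandomCubature lam d t P μ where
  aemeasurable := h.aemeasurable_fst
  mem_orbitSet := h.symm.ae_mem_snd (measurableSet_orbitSet lam d) hQ.mem_orbitSet
  moment_eq X hX := by
    rw [← hQ.moment_eq X hX]
    exact (h.comp (u := fun A => hsInner A X ^ t)
      ((continuous_hsInner_left X).pow t).measurable).integral_eq

theorem hsInner_add_right (A X Y : Matrix (Fin d) (Fin d) ℝ) :
    hsInner A (X + Y) = hsInner A X + hsInner A Y := by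
  simp only [hsInner, transpose_add, mul_add, trace_add]

theorem hsInner_sub_right (A X Y : Matrix (Fin d) (Fin d) ℝ) :
    hsInner A (X - Y) = hsInner A X - hsInner A Y := by
  simp only [hsInner, transpose_sub, mul_sub, trace_sub]

/-- A random variable whose cubes are integrable satisfies the polarization identity for mixed
third moments. -/
theorem integral_sq_mul_eq_polarization {u v : Ω → ℝ}
    (h1 : Integrable (fun ω => (u ω + v ω) ^ 3) μ)
    (h2 : Integrable (fun ω => (v ω - u ω) ^ 3) μ) (h3 : Integrable (fun ω => v ω ^ 3) μ) :
    ∫ ω, u ω ^ 2 * v ω ∂μ =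
      (∫ ω, (u ω + v ω) ^ 3 ∂μ + ∫ ω, (v ω - u ω) ^ 3 ∂μ - 2 * ∫ ω, v ω ^ 3 ∂μ) / 6 := by
  have e : ∀ ω, u ω ^ 2 * v ω =
      ((u ω + v ω) ^ 3 + (v ω - u ω) ^ 3 - 2 * v ω ^ 3) / 6 := fun ω => by ring
  simp only [e]
  have h12 : Integrable (fun ω => (u ω + v ω) ^ 3 + (v ω - u ω) ^ 3) μ := h1.add h2
  rw [integral_div, integral_sub h12 (h3.const_mul 2), integral_add h1 h2,
    integral_const_mul]

variable [IsProbabilityMeasure μ] {P : Ω → Matrix (Fin d) (Fin d) ℝ}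

theorem IsRandomCubature.integrable_comp {t : ℕ} (hP : IsRandomCubature lam d t P μ)
    (hpos : ∀ i, 0 < lam i) (hle : ∀ i, lam i ≤ 1) {f : Matrix (Fin d) (Fin d) ℝ → ℝ}
    (hf : Continuous f) : Integrable (fun ω => f (P ω)) μ :=
  integrable_continuous_comp hP.aemeasurable (C := 1)
    (hP.mem_orbitSet.mono fun _ h => abs_apply_le_one_of_mem_orbitSet hpos hle h) hf

theorem IsRandomCubature.integral_sq_mul_eq (hP : IsRandomCubature lam d 3 P μ)
    (hpos : ∀ i, 0 < lam i) (hle : ∀ i, lam i ≤ 1) {X Y : Matrix (Fin d) (Fin d) ℝ}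
    (hX : X.IsSymm) (hY : Y.IsSymm) :
    ∫ ω, hsInner (P ω) X ^ 2 * hsInner (P ω) Y ∂μ =
      ∫ O, hsInner (conjDiag lam d O) X ^ 2 * hsInner (conjDiag lam d O) Y ∂haarOrthogonal d := by
  have hc : ∀ Z : Matrix (Fin d) (Fin d) ℝ, Continuous fun A => hsInner A Z ^ 3 := fun Z =>
    (continuous_hsInner_left Z).pow 3
  have hm : ∀ Z : Matrix (Fin d) (Fin d) ℝ, Z.IsSymm → ∫ ω, hsInner (P ω) Z ^ 3 ∂μ =
      ∫ O, hsInner (conjDiag lam d O) Z ^ 3 ∂haarOrthogonal d := fun Z hZ =>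
    (hP.moment_eq Z hZ).trans (orbitTraceMoment_eq lam d 3 Z)
  have hiP := fun Z : Matrix (Fin d) (Fin d) ℝ => hP.integrable_comp hpos hle (hc Z)
  have hiO := fun Z : Matrix (Fin d) (Fin d) ℝ => integrable_comp_conjDiag lam (hc Z)
  have p1 := hiP (X + Y)
  have p2 := hiP (Y - X)
  have o1 := hiO (X + Y)
  have o2 := hiO (Y - X)
  have m1 := hm _ (hX.add hY)
  have m2 := hm _ (hY.sub hX)
  simp only [hsInner_add_right] at p1 o1 m1
  simp only [hsInner_sub_right] at p2 o2 m2
  rw [integral_sq_mul_eq_polarization p1 p2 (hiP Y), integral_sq_mul_eq_polarization o1 o2 (hiO Y),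
    m1, m2, hm Y hY]

/-- Strength 3 also controls second moments: take the identity as the third factor, on which every
orbit matrix has the same nonzero value `∑ λ_i`. -/
theorem IsRandomCubature.integral_sq_eq (hP : IsRandomCubature lam d 3 P μ)
    (hpos : ∀ i, 0 < lam i) (hle : ∀ i, lam i ≤ 1) (hk : 1 ≤ k) (hkd : k ≤ d)
    {X : Matrix (Fin d) (Fin d) ℝ} (hX : X.IsSymm) :
    ∫ ω, hsInner (P ω) X ^ 2 ∂μ =
      ∫ O, hsInner (conjDiag lam d O) X ^ 2 ∂haarOrthogonal d := by
  have hT0 : 0 < ∑ i, lam i :=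
    Finset.sum_pos (fun i _ => hpos i) ⟨⟨0, hk⟩, Finset.mem_univ _⟩
  have h := hP.integral_sq_mul_eq hpos hle hX isSymm_one
  have e1 : ∫ ω, hsInner (P ω) X ^ 2 * hsInner (P ω) 1 ∂μ =
      ∫ ω, hsInner (P ω) X ^ 2 * ∑ i, lam i ∂μ := by
    refine integral_congr_ae ?_
    filter_upwards [hP.mem_orbitSet] with ω hω
    rw [hsInner_one, trace_of_mem_orbitSet hkd hω]
  simp only [hsInner_one (conjDiag lam d _), trace_of_mem_orbitSet hkd (conjDiag_mem_orbitSet _)]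
    at h
  rw [e1, integral_mul_const, integral_mul_const] at h
  exact mul_right_cancel₀ hT0.ne' h

theorem IsRandomCubature.le_integral_sq (hP : IsRandomCubature lam d 3 P μ)
    (hpos : ∀ i, 0 < lam i) (hle : ∀ i, lam i ≤ 1) (hk : 1 ≤ k) (hkd : k < d)
    {x : Fin d → ℝ} (hx : x ⬝ᵥ x = 1) (z : Fin d → ℝ) :
    (∑ i, lam i ^ 2) / (2 * (k + 1)) / d ^ 2 * (z ⬝ᵥ z) ≤ ∫ ω, (x ⬝ᵥ P ω *ᵥ z) ^ 2 ∂μ := by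
  have h := hP.integral_sq_eq hpos hle hk hkd.le (isSymm_tangent x z)
  have e1 : ∫ ω, hsInner (P ω) (vecMulVec x z + vecMulVec z x) ^ 2 ∂μ =
      ∫ ω, 2 ^ 2 * (x ⬝ᵥ P ω *ᵥ z) ^ 2 ∂μ := by
    refine integral_congr_ae ?_
    filter_upwards [hP.mem_orbitSet] with ω hω
    rw [hsInner_tangent (isSymm_of_mem_orbitSet hω), mul_pow]
  simp only [e1, hsInner_tangent (isSymm_of_mem_orbitSet (conjDiag_mem_orbitSet _)), mul_pow,
    integral_const_mul] at h
  have h2 := le_integral_sq_dotProduct hpos hkd hk x z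
  rw [hx, one_mul] at h2
  linarith

theorem IsRandomCubature.integral_mul_sq_le (hP : IsRandomCubature lam d 3 P μ)
    (hpos : ∀ i, 0 < lam i) (hle : ∀ i, lam i ≤ 1) (hk : 1 ≤ k) (hkd : k ≤ d)
    {x : Fin d → ℝ} (hx : x ⬝ᵥ x = 1) (z : Fin d → ℝ) :
    ∫ ω, (x ⬝ᵥ P ω *ᵥ x) * (x ⬝ᵥ P ω *ᵥ z) ^ 2 ∂μ ≤
      15 * (∑ i, lam i) ^ 3 / d ^ 3 * (z ⬝ᵥ z) := by
  have hxs : (vecMulVec x x).IsSymm := transpose_vecMulVec x x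
  have h := hP.integral_sq_mul_eq hpos hle (isSymm_tangent x z) hxs
  have e : ∀ A : Matrix (Fin d) (Fin d) ℝ, A.IsSymm →
      hsInner A (vecMulVec x z + vecMulVec z x) ^ 2 * hsInner A (vecMulVec x x) =
        4 * ((x ⬝ᵥ A *ᵥ x) * (x ⬝ᵥ A *ᵥ z) ^ 2) := fun A hA => by
    rw [hsInner_tangent hA, hsInner_vecMulVec_self]; ring
  have e1 : ∫ ω, hsInner (P ω) (vecMulVec x z + vecMulVec z x) ^ 2 *
      hsInner (P ω) (vecMulVec x x) ∂μ =
      ∫ ω, 4 * ((x ⬝ᵥ P ω *ᵥ x) * (x ⬝ᵥ P ω *ᵥ z) ^ 2) ∂μ := by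
    refine integral_congr_ae ?_
    filter_upwards [hP.mem_orbitSet] with ω hω
    exact e _ (isSymm_of_mem_orbitSet hω)
  simp only [e1, e _ (isSymm_of_mem_orbitSet (conjDiag_mem_orbitSet _)), integral_const_mul] at h
  have h2 := PhaseRetrieval.integral_mul_sq_le (lam := lam) hpos hk hkd hx z
  linarith

end Cubature

/-! ### Matrix Chernoff bound and reduction to it -/

section Concentration

variable {k d : ℕ} {lam : Fin k → ℝ} {Ω : Type*} [MeasurableSpace Ω] {μ : Measure Ω}

/-- Rescaling `x` can be absorbed in `z`; for `x = 0` the tangent space is trivial and any unit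
vector serves. -/
theorem exists_unit_tangentSpace_subset (hd : 0 < d) (x : Fin d → ℝ) :
    ∃ y : Fin d → ℝ, y ⬝ᵥ y = 1 ∧ tangentSpace x ⊆ tangentSpace y := by
  by_cases hx : x = 0
  · refine ⟨Pi.single ⟨0, hd⟩ 1, by simp, ?_⟩
    rintro X ⟨z, rfl⟩
    exact ⟨0, by simp [hx]⟩
  · have hxx : 0 < x ⬝ᵥ x := lt_of_le_of_ne (Finset.sum_nonneg fun i _ => mul_self_nonneg _)
      (Ne.symm (mt dotProduct_self_eq_zero.mp hx))
    set r := √(x ⬝ᵥ x) with hr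
    have hr0 : 0 < r := Real.sqrt_pos.mpr hxx
    have hrr : r * r = x ⬝ᵥ x := Real.mul_self_sqrt hxx.le
    refine ⟨r⁻¹ • x, ?_, ?_⟩
    · simp only [dotProduct_smul, smul_dotProduct, smul_eq_mul, ← hrr]
      field_simp
    · rintro X ⟨z, rfl⟩
      refine ⟨r • z, ?_⟩
      simp only [smul_vecMulVec, vecMulVec_smul, smul_smul, mul_inv_cancel₀ hr0.ne',
        inv_mul_cancel₀ hr0.ne', one_smul]

/-- The scaled rank-one matrix of the quadratic form `z ↦ θ (P x ⬝ z) ^ 2`. -/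
def rankOneForm (θ : ℝ) (x : Fin d → ℝ) (P : Matrix (Fin d) (Fin d) ℝ) :
    Matrix (Fin d) (Fin d) ℝ :=
  θ • vecMulVec (P *ᵥ x) (P *ᵥ x)

theorem continuous_rankOneForm (θ : ℝ) (x : Fin d → ℝ) : Continuous (rankOneForm θ x) := by
  unfold rankOneForm
  fun_prop

theorem isSymm_rankOneForm (θ : ℝ) (x : Fin d → ℝ) (P : Matrix (Fin d) (Fin d) ℝ) :
    (rankOneForm θ x P).IsSymm := by
  rw [rankOneForm, IsSymm, transpose_smul, transpose_vecMulVec]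

theorem dotProduct_vecMulVec_self_mulVec (p z : Fin d → ℝ) :
    z ⬝ᵥ vecMulVec p p *ᵥ z = (p ⬝ᵥ z) ^ 2 := by
  rw [vecMulVec_mulVec, op_smul_eq_smul, dotProduct_smul, smul_eq_mul, dotProduct_comm z p,
    pow_two]

theorem dotProduct_rankOneForm_mulVec {P : Matrix (Fin d) (Fin d) ℝ} (hP : P.IsSymm) (θ : ℝ)
    (x z : Fin d → ℝ) : z ⬝ᵥ rankOneForm θ x P *ᵥ z = θ * (x ⬝ᵥ P *ᵥ z) ^ 2 := by
  rw [rankOneForm, smul_mulVec, dotProduct_smul, smul_eq_mul, dotProduct_vecMulVec_self_mulVec,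
    dotProduct_mulVec_comm_of_isSymm hP]

theorem dotProduct_quadratic_rankOneForm_mulVec {P : Matrix (Fin d) (Fin d) ℝ} (hP : P.IsSymm)
    (θ : ℝ) (x z : Fin d → ℝ) :
    z ⬝ᵥ (1 - rankOneForm θ x P + (2⁻¹ : ℝ) • rankOneForm θ x P ^ 2) *ᵥ z =
      z ⬝ᵥ z - θ * (x ⬝ᵥ P *ᵥ z) ^ 2 +
        2⁻¹ * θ ^ 2 * ((P *ᵥ x ⬝ᵥ P *ᵥ x) * (x ⬝ᵥ P *ᵥ z) ^ 2) := by
  have e : rankOneForm θ x P ^ 2 =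
      (θ ^ 2 * (P *ᵥ x ⬝ᵥ P *ᵥ x)) • vecMulVec (P *ᵥ x) (P *ᵥ x) := by
    rw [pow_two, rankOneForm, Matrix.smul_mul, Matrix.mul_smul, vecMulVec_mul_vecMulVec,
      vecMulVec_smul, smul_smul, smul_smul]
    congr 1; ring
  rw [e, add_mulVec, sub_mulVec, one_mulVec, smul_mulVec, smul_mulVec, dotProduct_add,
    dotProduct_sub, dotProduct_smul, dotProduct_smul, smul_eq_mul, smul_eq_mul,
    dotProduct_rankOneForm_mulVec hP, dotProduct_vecMulVec_self_mulVec,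
    dotProduct_mulVec_comm_of_isSymm hP]
  ring

theorem abs_rankOneForm_apply_le (hpos : ∀ i, 0 < lam i) (hle : ∀ i, lam i ≤ 1) {θ : ℝ}
    (hθ : 0 ≤ θ) {x : Fin d → ℝ} (hx : x ⬝ᵥ x = 1) {P : Matrix (Fin d) (Fin d) ℝ}
    (hP : P ∈ orbitSet lam d) (a b : Fin d) : |rankOneForm θ x P a b| ≤ θ := by
  have h1 := dotProduct_mulVec_self_le_of_mem_orbitSet hpos hle hP x
  have h2 := dotProduct_mulVec_le_of_mem_orbitSet hle hP x
  have h3 : ∀ i, |(P *ᵥ x) i| ≤ 1 := fun i => by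
    rw [abs_le_one_iff_mul_self_le_one]
    refine le_trans ?_ ((h1.trans h2).trans hx.le)
    exact Finset.single_le_sum (f := fun i => (P *ᵥ x) i * (P *ᵥ x) i)
      (fun i _ => mul_self_nonneg _) (Finset.mem_univ i)
  rw [rankOneForm, Matrix.smul_apply, vecMulVec_apply, smul_eq_mul, abs_mul, abs_mul, abs_of_nonneg hθ]
  exact mul_le_of_le_one_right hθ (mul_le_one₀ (h3 a) (abs_nonneg _) (h3 b))

/-- One-sided matrix Chernoff bound for the forms `z ↦ ∑ j, (x ⬝ P j z) ^ 2`. -/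
theorem measureReal_exp_le_trace_le [IsProbabilityMeasure μ] (hpos : ∀ i, 0 < lam i)
    (hle : ∀ i, lam i ≤ 1) (hk : 1 ≤ k) (hkd : k < d) {n : ℕ}
    {P : Fin n → Ω → Matrix (Fin d) (Fin d) ℝ} (hP : ∀ j, IsRandomCubature lam d 3 (P j) μ)
    (hindep : iIndepFun P μ) {x : Fin d → ℝ} (hx : x ⬝ᵥ x = 1) {a b : ℝ}
    (ha : a = (∑ i, lam i ^ 2) / (2 * (k + 1)) / d ^ 2)
    (hb : b = 15 * (∑ i, lam i) ^ 3 / d ^ 3) :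
    μ.real {ω | Real.exp (-(n * (a / b) * a / 4)) ≤
        (NormedSpace.exp (-∑ j, rankOneForm (a / b) x (P j ω))).trace} ≤
      d * Real.exp (-(n * (a ^ 2 / (4 * b)))) := by
  have hd0 : (0 : ℝ) < d := by exact_mod_cast (by omega : 0 < d)
  have hne : (Finset.univ : Finset (Fin k)).Nonempty := ⟨⟨0, hk⟩, Finset.mem_univ _⟩
  have hT0 : 0 < ∑ i, lam i := Finset.sum_pos (fun i _ => hpos i) hne
  have hN0 : 0 < ∑ i, lam i ^ 2 := Finset.sum_pos (fun i _ => pow_pos (hpos i) 2) hne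
  have ha0 : 0 < a := by rw [ha]; positivity
  have hb0 : 0 < b := by rw [hb]; positivity
  -- The minimizer of `1 - θa + θ²b/2`, with minimum `1 - a²/(2b) ≤ ρ`.
  set θ := a / b with hθ
  have hθ0 : 0 < θ := by positivity
  set ρ := Real.exp (-(a ^ 2 / (2 * b))) with hρ
  have hM : ∀ j, AEMeasurable (fun ω => rankOneForm θ x (P j ω)) μ := fun j =>
    (continuous_rankOneForm θ x).measurable.comp_aemeasurable (hP j).aemeasurable
  have hbdd : ∀ j, ∀ᵐ ω ∂μ, ∀ a b, |rankOneForm θ x (P j ω) a b| ≤ θ := fun j =>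
    (hP j).mem_orbitSet.mono fun ω h => abs_rankOneForm_apply_le hpos hle hθ0.le hx h
  have hmean : ∀ j z, ∫ ω, z ⬝ᵥ (1 - rankOneForm θ x (P j ω) +
      (2⁻¹ : ℝ) • rankOneForm θ x (P j ω) ^ 2) *ᵥ z ∂μ ≤ ρ * (z ⬝ᵥ z) := by
    intro j z
    have hzz : 0 ≤ z ⬝ᵥ z := Finset.sum_nonneg fun i _ => mul_self_nonneg _
    have i1 := (hP j).integrable_comp hpos hle (f := fun A => (x ⬝ᵥ A *ᵥ z) ^ 2) (by fun_prop)
    have i2 := (hP j).integrable_comp hpos hle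
      (f := fun A => (x ⬝ᵥ A *ᵥ x) * (x ⬝ᵥ A *ᵥ z) ^ 2) (by fun_prop)
    have i3 := (hP j).integrable_comp hpos hle (f := fun A => z ⬝ᵥ (1 - rankOneForm θ x A +
      (2⁻¹ : ℝ) • rankOneForm θ x A ^ 2) *ᵥ z) (by
        have := continuous_rankOneForm θ x
        fun_prop)
    have i4 : Integrable (fun ω => z ⬝ᵥ z - θ * (x ⬝ᵥ P j ω *ᵥ z) ^ 2) μ :=
      (integrable_const _).sub (i1.const_mul θ)
    have i5 : Integrable (fun ω => 2⁻¹ * θ ^ 2 *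
        ((x ⬝ᵥ P j ω *ᵥ x) * (x ⬝ᵥ P j ω *ᵥ z) ^ 2)) μ := i2.const_mul _
    have h1 : ∫ ω, z ⬝ᵥ (1 - rankOneForm θ x (P j ω) +
        (2⁻¹ : ℝ) • rankOneForm θ x (P j ω) ^ 2) *ᵥ z ∂μ ≤
        ∫ ω, (z ⬝ᵥ z - θ * (x ⬝ᵥ P j ω *ᵥ z) ^ 2 +
          2⁻¹ * θ ^ 2 * ((x ⬝ᵥ P j ω *ᵥ x) * (x ⬝ᵥ P j ω *ᵥ z) ^ 2)) ∂μ := by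
      refine integral_mono_ae i3 (i4.add i5) ?_
      filter_upwards [(hP j).mem_orbitSet] with ω hω
      rw [dotProduct_quadratic_rankOneForm_mulVec (isSymm_of_mem_orbitSet hω)]
      have := dotProduct_mulVec_self_le_of_mem_orbitSet hpos hle hω x
      gcongr
    rw [integral_add i4 i5, integral_sub (integrable_const _) (i1.const_mul θ),
      integral_const_mul, integral_const_mul, integral_const, probReal_univ, one_smul] at h1
    have h2 := (hP j).le_integral_sq hpos hle hk hkd hx z
    have h3 := (hP j).integral_mul_sq_le hpos hle hk hkd.le hx z
    rw [← ha] at h2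
    rw [← hb] at h3
    have h4 := mul_le_mul_of_nonneg_left h2 hθ0.le
    have h5 := mul_le_mul_of_nonneg_left h3 (by positivity : 0 ≤ 2⁻¹ * θ ^ 2)
    have h6 : 1 - θ * a + 2⁻¹ * θ ^ 2 * b ≤ ρ := by
      have : 1 - θ * a + 2⁻¹ * θ ^ 2 * b = 1 - a ^ 2 / (2 * b) := by
        rw [hθ]; field_simp; ring
      rw [this]
      exact Real.one_sub_le_exp_neg _
    have h7 := mul_le_mul_of_nonneg_right h6 hzz
    linarith
  have hL := integral_trace_exp_neg_sum_le (μ := μ)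
    (M := fun j ω => rankOneForm θ x (P j ω))
    (hindep.comp (fun _ => rankOneForm θ x) fun _ => (continuous_rankOneForm θ x).measurable)
    hM (fun j => Filter.Eventually.of_forall fun ω => isSymm_rankOneForm θ x _)
    (fun j => (hP j).mem_orbitSet.mono fun ω hω z => by
      rw [dotProduct_rankOneForm_mulVec (isSymm_of_mem_orbitSet hω)]
      positivity)
    hbdd (Real.exp_pos _).le hmean Finset.univ
  rw [Finset.card_univ, Fintype.card_fin] at hL
  have hSmeas : AEMeasurable (fun ω => ∑ j, rankOneForm θ x (P j ω)) μ :=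
    Finset.aemeasurable_fun_sum _ fun j _ => hM j
  have hSbdd : ∀ᵐ ω ∂μ, ∀ a b, |(∑ j, rankOneForm θ x (P j ω)) a b| ≤ n * θ := by
    filter_upwards [ae_all_iff.mpr hbdd] with ω hω a b
    rw [Matrix.sum_apply]
    refine (Finset.abs_sum_le_sum_abs _ _).trans ?_
    refine (Finset.sum_le_sum fun j _ => hω j a b).trans ?_
    simp
  have hSymm : ∀ ω, (∑ j, rankOneForm θ x (P j ω)).IsSymm := fun ω => by
    rw [IsSymm, transpose_sum]
    exact Finset.sum_congr rfl fun j _ => isSymm_rankOneForm θ x _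
  -- The threshold is `exp(-n a²/(4b))`, and the transform is at most `d · exp(-n a²/(2b))`, so half
  -- of the exponent survives.
  have hmarkov := mul_meas_ge_le_integral_of_nonneg
    (Filter.Eventually.of_forall fun ω => by
      have h := trace_exp_mul_nonneg (B := 1) (hSymm ω).neg fun z => by
        rw [one_mulVec]; exact Finset.sum_nonneg fun i _ => mul_self_nonneg _
      rwa [mul_one] at h)
    (integrable_continuous_comp hSmeas hSbdd continuous_exp_neg.matrix_trace)
    (Real.exp (-(n * θ * a / 4)))
  have hfin := hmarkov.trans hL
  rw [mul_comm, ← le_div_iff₀ (Real.exp_pos _)] at hfin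
  refine hfin.trans (le_of_eq ?_)
  rw [← Real.exp_nat_mul, mul_comm (Real.exp _) (d : ℝ), mul_div_assoc, ← Real.exp_sub]
  congr 2
  rw [hθ]
  field_simp
  ring

/-- If the measurements are too small on some element of the tangent space at a unit vector, then
the Laplace transform of the associated quadratic form is large. -/
theorem exp_le_trace_of_exists_tangent {n : ℕ} (hn : 1 ≤ n) {P : Fin n → Matrix (Fin d) (Fin d) ℝ}
    (hP : ∀ j, (P j).IsSymm) {x : Fin d → ℝ} (hx : x ⬝ᵥ x = 1) {a θ ε : ℝ} (hθ : 0 ≤ θ)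
    (hε0 : 0 ≤ ε) (hε : ε ≤ a / 4)
    (h : ¬ ∀ X ∈ tangentSpace x, ε * frobNorm X ^ 2 ≤ 1 / (n : ℝ) * ‖measurementMap P X‖ ^ 2) :
    Real.exp (-(n * θ * a / 4)) ≤ (NormedSpace.exp (-∑ j, rankOneForm θ x (P j))).trace := by
  push Not at h
  obtain ⟨X, ⟨z, rfl⟩, hX⟩ := h
  have hn0 : (0 : ℝ) < n := by exact_mod_cast hn
  have hzz : 0 ≤ z ⬝ᵥ z := Finset.sum_nonneg fun i _ => mul_self_nonneg _
  have hCS : (x ⬝ᵥ z) ^ 2 ≤ z ⬝ᵥ z := by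
    have h := Finset.sum_mul_sq_le_sq_mul_sq Finset.univ x z
    simp only [dotProduct, ← pow_two] at hx ⊢
    rwa [hx, one_mul] at h
  have hfrob : frobNorm (vecMulVec x z + vecMulVec z x) ^ 2 = 2 * (z ⬝ᵥ z + (x ⬝ᵥ z) ^ 2) := by
    rw [frobNorm, hsInner_tangent_self, hx, one_mul, Real.sq_sqrt (by positivity)]
  have hmeas : ‖measurementMap P (vecMulVec x z + vecMulVec z x)‖ ^ 2 =
      4 * ∑ j, (x ⬝ᵥ P j *ᵥ z) ^ 2 := by
    rw [EuclideanSpace.norm_sq_eq, Finset.mul_sum]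
    refine Finset.sum_congr rfl fun j _ => ?_
    rw [measurementMap, PiLp.toLp_apply, hsInner_comm, hsInner_tangent (hP j), Real.norm_eq_abs,
      sq_abs]
    ring
  rw [hfrob, hmeas] at hX
  have hz : z ≠ 0 := by
    rintro rfl
    simp at hX
  -- Uses `(x·z)² ≤ |z|²`; the 4 matches the factor 4 in the squared measurements, leaving a quarter
  -- of the mean level.
  have h1 : ε * (2 * (z ⬝ᵥ z + (x ⬝ᵥ z) ^ 2)) ≤ a / 4 * (4 * (z ⬝ᵥ z)) := by
    refine mul_le_mul hε (by linarith) (by positivity) (hε0.trans hε)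
  have h2 : ∑ j, (x ⬝ᵥ P j *ᵥ z) ^ 2 ≤ n * a / 4 * (z ⬝ᵥ z) := by
    have h3 := hX.le.trans h1
    rw [one_div, inv_mul_le_iff₀ hn0] at h3
    linarith
  refine exp_neg_le_trace_exp_neg ?_ hz ?_
  · rw [IsSymm, transpose_sum]
    exact Finset.sum_congr rfl fun j _ => isSymm_rankOneForm θ x _
  · rw [sum_mulVec, dotProduct_sum]
    simp only [dotProduct_rankOneForm_mulVec (hP _)]
    rw [← Finset.mul_sum]
    have h4 := mul_le_mul_of_nonneg_left h2 hθ
    linarith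

end Concentration

end PhaseRetrieval

theorem theorem6p1 (k : ℕ) (hk : 1 ≤ k) (lam : Fin k → ℝ) (hanti : Antitone lam)
    (hpos : ∀ i, 0 < lam i) (hle : ∀ i, lam i ≤ 1) :
    ∃ K : ℝ, 0 < K ∧ ∀ C₀ : ℝ, K ≤ C₀ → ∃ c : ℝ, 0 < c ∧
      ∀ (d : ℕ), k < d → ∀ (n : ℕ), 1 ≤ n → ∀ (x : Fin d → ℝ)
        {Ω : Type*} {Ω' : Type*} [MeasurableSpace Ω] [MeasurableSpace Ω']
        (μ : MeasureTheory.Measure Ω) [MeasureTheory.IsProbabilityMeasure μ]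
        (μ' : MeasureTheory.Measure Ω') [MeasureTheory.IsProbabilityMeasure μ']
        (Q : Ω' → Matrix (Fin d) (Fin d) ℝ) (P : Fin n → Ω → Matrix (Fin d) (Fin d) ℝ),
        PhaseRetrieval.IsRandomCubature lam d 3 Q μ' →
        (∀ j, ProbabilityTheory.IdentDistrib (P j) Q μ μ') →
        ProbabilityTheory.iIndepFun P μ →
        μ {ω | ¬ ∀ X ∈ PhaseRetrieval.tangentSpace x,
            1 / (C₀ * (d : ℝ) ^ 2) * PhaseRetrieval.frobNorm X ^ 2 ≤
              1 / (n : ℝ) * ‖PhaseRetrieval.measurementMap (fun j => P j ω) X‖ ^ 2}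
          ≤ ENNReal.ofReal ((d : ℝ) ^ 2 * Real.exp (-c * ((n : ℝ) / (d : ℝ)))) := by
  have hne : (Finset.univ : Finset (Fin k)).Nonempty := ⟨⟨0, hk⟩, Finset.mem_univ _⟩
  have hT0 : 0 < ∑ i, lam i := Finset.sum_pos (fun i _ => hpos i) hne
  have hN0 : 0 < ∑ i, lam i ^ 2 := Finset.sum_pos (fun i _ => pow_pos (hpos i) 2) hne
  set c₁ : ℝ := (∑ i, lam i ^ 2) / (2 * (k + 1)) with hc₁
  set c₂ : ℝ := 15 * (∑ i, lam i) ^ 3 with hc₂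
  have hc₁0 : 0 < c₁ := by positivity
  have hc₂0 : 0 < c₂ := by positivity
  -- With `a = c₁/d²` and `b = c₂/d³`, the condition `1/(C₀d²) ≤ a/4` reads `C₀ ≥ 4/c₁`, and
  -- `a²/(4b) = c₁²/(4c₂) · 1/d`. The rate is uniform in `C₀`.
  refine ⟨4 / c₁, by positivity, fun C₀ hC₀ => ⟨c₁ ^ 2 / (4 * c₂), by positivity, ?_⟩⟩
  intro d hkd n hn x Ω Ω' _ _ μ _ μ' _ Q P hQ hid hindep
  have hC0 : 0 < C₀ := lt_of_lt_of_le (by positivity) hC₀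
  have hd1 : (1 : ℝ) ≤ d := by exact_mod_cast (by omega : 1 ≤ d)
  have hd0 : (0 : ℝ) < d := by linarith
  obtain ⟨y, hy, hxy⟩ := PhaseRetrieval.exists_unit_tangentSpace_subset (by omega : 0 < d) x
  have hP : ∀ j, PhaseRetrieval.IsRandomCubature lam d 3 (P j) μ := fun j =>
    hQ.of_identDistrib (hid j)
  have hmain := PhaseRetrieval.measureReal_exp_le_trace_le hpos hle hk hkd hP hindep hy
    (a := c₁ / d ^ 2) (b := c₂ / d ^ 3) (by rw [hc₁]) (by rw [hc₂])
  have hε : 1 / (C₀ * (d : ℝ) ^ 2) ≤ c₁ / d ^ 2 / 4 := by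
    rw [div_le_iff₀ hc₁0] at hC₀
    rw [div_div, div_le_div_iff₀ (by positivity) (by positivity)]
    nlinarith [mul_le_mul_of_nonneg_right hC₀ (sq_nonneg (d : ℝ))]
  refine (MeasureTheory.measure_mono_ae ?_).trans
    ((MeasureTheory.ofReal_measureReal (μ := μ)).symm.le.trans
      (ENNReal.ofReal_le_ofReal (hmain.trans ?_)))
  · filter_upwards [MeasureTheory.ae_all_iff.mpr fun j => (hP j).mem_orbitSet] with ω hω hbad
    refine PhaseRetrieval.exp_le_trace_of_exists_tangent hn
      (fun j => PhaseRetrieval.isSymm_of_mem_orbitSet (hω j)) hy (by positivity) (by positivity)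
      hε fun hall => hbad fun X hX => hall X (hxy hX)
  · have e : (n : ℝ) * ((c₁ / d ^ 2) ^ 2 / (4 * (c₂ / d ^ 3))) =
        c₁ ^ 2 / (4 * c₂) * (n / d) := by
      field_simp
    rw [e, neg_mul]
    -- The argument gives the prefactor `d`, which is at most `d²`.
    exact mul_le_mul_of_nonneg_right (by nlinarith) (Real.exp_pos _).le
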